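/- Theorem 2.3. Let $S$ be a non-empty set, and identify $S^2$ with $\mathbb R^2\cup\{\infty\}$. Everything below is smooth and lies in $\mathbb R^2$. For words $u,v$ on $S\cup S^{-1}$ write $(u,v)=u^{-1}v^{-1}uv$ and $u^v=v^{-1}uv$. A *commutator identity* $w_1\cdots w_m\equiv 1$ consists of words $w_i$ on $S\cup S^{-1}$, each representing an element of the commutator subgroup of the free group on $S$, whose product represents the identity element. It is *elementary* if, as words, $w_i=(a_i,b_i)^{u_i}$ with $a_i,b_i\in S$ and $u_i$ a word on $S\cup S^{-1}$, for each $i=1,\dots,m$. Let $D$ be an $S$-colored oriented doodle diagram, that is, a finite collection of oriented immersed circles, each labelled by an element of $S$, whose multiple points are transverse double points (the crossings). A *noose* is the image $N$ of an embedding of $X=\{x^2+y^2\le 1\}\cup([1,2]\times\{0\})$ in $\mathbb R^2$; its head, loop, rope, neck and root are the images of the disk, of the unit circle, of $[1,2]\times\{0\}$, of $(1,0)$ and of $(2,0)$. The loop is oriented counterclockwise. It is a noose *for $D$* if its root and neck miss $D$ and its loop and rope are transverse to the components of $D$ and disjoint from the crossings. The *intersection word* of $N$ with $D$ is read along the path that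 starts at the root, follows the rope to the neck, runs once counterclockwise along the loop and returns along the rope: an intersection with a component labelled $a$ contributes $a$ if the path crosses the component from its right to its left, and $a^{-1}$ otherwise. A noose for $D$ is *proper* if (P1) the intersection of $D$ and the head is a union of two embedded arcs which intersect each other in a single point, and (P2) starting at the neck, the loop passes, in this order, across a component of $D$ from left to right, across a component of $D$ from left to right, across the former component from right to left and across the latter component from right to left, and meets $D$ nowhere else. Let $\mathcal N=(N_1,\dots,N_m)$ be a noose system for $D$: the $N_i$ are nooses for $D$ which have a common root, the base point, and are otherwise mutually disjoint; their ropes appear counterclockwise in this order around the base point; and every crossing of $D$ lies in a head. Let $w_i$ be the intersection word of $N_i$ with $D$. If every $N_i$ is proper, then $w_1\cdots w_m\equiv 1$ is an elementary commutator identity: there are $a_i,b_i\in S$ and words $u_i$ on $S\cup S^{-1}$ with $$w_i=(a_i,b_i)^{u_i}\quad(i=1,\dots,m)\qquad\text{and}\qquad (a_1,b_1)^{u_1}\cdots(a_m,b_m)^{u_m}\equiv 1$$ in the free group on $S$. -/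

import Mathlib

open Set Filter Topology
open scoped ContDiff

/-! The plane `ℝ² = S² ∖ {∞}` is modelled by `ℂ`, so that `x + y i` stands for `(x, y)`. -/

namespace Doodle

/-! ### Words on `S ∪ S⁻¹` -/

/-- A word on `S ∪ S⁻¹`; the letter `(a, true)` is `a`, the letter `(a, false)` is `a⁻¹`. -/
abbrev SignedWord (S : Type*) := List (S × Bool)

/-- The word `(u, v) = u⁻¹ v⁻¹ u v`. -/
def commWord {S : Type*} (u v : SignedWord S) : SignedWord S :=
  FreeGroup.invRev u ++ FreeGroup.invRev v ++ u ++ v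

/-- The word `u ^ v = v⁻¹ u v`. -/
def conjWord {S : Type*} (u v : SignedWord S) : SignedWord S :=
  FreeGroup.invRev v ++ u ++ v

/-- The one-letter word `a`. -/
def letterWord {S : Type*} (a : S) : SignedWord S := [(a, true)]

/-- `w₁ ⋯ wₘ ≡ 1` is a commutator identity: every `wᵢ` represents an element of the commutator
subgroup of the free group on `S`, and the product represents the identity. -/
def IsCommutatorIdentity {S : Type*} {m : ℕ} (w : Fin m → SignedWord S) : Prop :=
  (∀ i, FreeGroup.mk (w i) ∈ commutator (FreeGroup S)) ∧
    FreeGroup.mk (List.ofFn w).flatten = 1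

/-- The commutator identity `w₁ ⋯ wₘ ≡ 1` is elementary: it is written in the form
`(a₁, b₁)^{u₁} ⋯ (aₘ, bₘ)^{uₘ} ≡ 1` with letters `aᵢ, bᵢ ∈ S` and words `uᵢ`
(these are equalities of words, not only of elements of the free group). -/
def IsElementaryCommutatorIdentity {S : Type*} {m : ℕ} (w : Fin m → SignedWord S) : Prop :=
  IsCommutatorIdentity w ∧
    ∃ (a b : Fin m → S) (u : Fin m → SignedWord S),
      ∀ i, w i = conjWord (commWord (letterWord (a i)) (letterWord (b i))) (u i)

/-! ### Coloured oriented doodle diagrams -/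

/-- The determinant of the pair of plane vectors `(u, v)`; it is positive exactly when `v` points to
the left of `u`. -/
def cross (u v : ℂ) : ℝ := u.re * v.im - u.im * v.re

/-- An `S`-coloured oriented doodle diagram in the plane: finitely many oriented immersed circles,
each labelled by an element of `S`, whose multiple points are transverse double points.
A circle is given by a smooth regular `1`-periodic parametrization, which also orients it; the points
of the source circle are the parameters in `[0, 1)`. -/
structure ColoredDiagram (S : Type*) where
  /-- the number of components -/
  n : ℕ
  curve : Fin n → ℝ → ℂ
  label : Fin n → S
  smooth : ∀ i, ContDiff ℝ ∞ (curve i)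
  periodic : ∀ i, Function.Periodic (curve i) 1
  immersed : ∀ i t, deriv (curve i) t ≠ 0
  /-- no point of the plane is passed more than twice -/
  double : ∀ p : ℂ, {x : Fin n × ℝ | x.2 ∈ Ico (0 : ℝ) 1 ∧ curve x.1 x.2 = p}.encard ≤ 2
  /-- two different passages through the same point are transverse -/
  transverse : ∀ i j, ∀ s ∈ Ico (0 : ℝ) 1, ∀ t ∈ Ico (0 : ℝ) 1, (i, s) ≠ (j, t) →
    curve i s = curve j t → cross (deriv (curve i) s) (deriv (curve j) t) ≠ 0

namespace ColoredDiagram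

variable {S : Type*} (D : ColoredDiagram S)

/-- The diagram as a subset of the plane. -/
def support : Set ℂ := {p | ∃ i t, D.curve i t = p}

/-- The set of crossings. -/
def crossings : Set ℂ :=
  {p | ∃ i j, ∃ s ∈ Ico (0 : ℝ) 1, ∃ t ∈ Ico (0 : ℝ) 1, (i, s) ≠ (j, t) ∧
    D.curve i s = p ∧ D.curve j t = p}

/-- At time `t` the path `α` is transverse to the components of the diagram and avoids the
crossings. -/
def TransverseAt (α : ℝ → ℂ) (t : ℝ) : Prop :=
  α t ∉ D.crossings ∧
    ∀ i s, D.curve i s = α t → cross (deriv (D.curve i) s) (deriv α t) ≠ 0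

/-- At time `t` the path `α` passes across the component `i` from right to left. -/
def PassesRightToLeft (α : ℝ → ℂ) (t : ℝ) (i : Fin D.n) : Prop :=
  ∃ s, D.curve i s = α t ∧ 0 < cross (deriv (D.curve i) s) (deriv α t)

/-- At time `t` the path `α` passes across the component `i` from left to right. -/
def PassesLeftToRight (α : ℝ → ℂ) (t : ℝ) (i : Fin D.n) : Prop :=
  ∃ s, D.curve i s = α t ∧ cross (deriv (D.curve i) s) (deriv α t) < 0

/-- `l` is the intersection letter of the path `α` with the diagram at time `t`: the label of the
component, with exponent `+1` for a passage from right to left and `-1` otherwise. -/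
def IsIntersectionLetter (α : ℝ → ℂ) (t : ℝ) (l : S × Bool) : Prop :=
  ∃ i, (D.PassesRightToLeft α t i ∧ l = (D.label i, true)) ∨
    (D.PassesLeftToRight α t i ∧ l = (D.label i, false))

/-- `w` is the intersection word along the path `α : [a, b] → ℂ` with the diagram: there are finitely
many times of intersection, and `w` lists the intersection letters in the order of these times. -/
def IsIntersectionWord (α : ℝ → ℂ) (a b : ℝ) (w : SignedWord S) : Prop :=
  ∃ ts : List ℝ, ts.Pairwise (· < ·) ∧
    (∀ t, t ∈ ts ↔ t ∈ Icc a b ∧ α t ∈ D.support) ∧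
    List.Forall₂ (fun t l => D.IsIntersectionLetter α t l) ts w

end ColoredDiagram

/-! ### Nooses -/

/-- The segment `I' = [1, 2] × {0}`. -/
def ropeModel : Set ℂ := {z | ∃ x ∈ Icc (1 : ℝ) 2, (x : ℂ) = z}

/-- The model `X = D² ∪ I'` of a noose. -/
def nooseModel : Set ℂ := Metric.closedBall 0 1 ∪ ropeModel

/-- A noose in the plane, given by a smooth embedding of `X`: the restriction to `X` of a map that is
smooth on a neighbourhood of `X`, is injective on `X`, and has invertible derivative at the points of
`X`. As `X` is invariant under reflection in the first axis, the embedding may be taken to preserve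
the orientation; then it carries the counterclockwise loop of `D²` to the counterclockwise loop of the
noose. Only the values on `X` matter. -/
structure Noose where
  toFun : ℂ → ℂ
  smooth : ∃ U : Set ℂ, IsOpen U ∧ nooseModel ⊆ U ∧ ContDiffOn ℝ ∞ toFun U
  injOn : Set.InjOn toFun nooseModel
  orientation : ∀ z ∈ nooseModel, 0 < (fderiv ℝ toFun z).det

namespace Noose

variable (N : Noose)

/-- The noose as a subset of the plane. -/
def image : Set ℂ := N.toFun '' nooseModel

def head : Set ℂ := N.toFun '' Metric.closedBall 0 1

def rope : Set ℂ := N.toFun '' ropeModel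

def neck : ℂ := N.toFun 1

def root : ℂ := N.toFun 2

/-- The loop as a closed path, run through once counterclockwise from the neck for
`s ∈ [0, 1]`. -/
noncomputable def loopPath (s : ℝ) : ℂ := N.toFun (Complex.exp ((2 * Real.pi * s : ℝ) * Complex.I))

/-- The rope as a path, from the neck (`x = 1`) to the root (`x = 2`). -/
def ropePath (x : ℝ) : ℂ := N.toFun (x : ℂ)

/-- The path `ℓ_N`, for `t ∈ [0, 3]`: from the root along the rope to the neck, once counterclockwise
along the loop, and back along the rope to the root. -/
noncomputable def path (t : ℝ) : ℂ :=
  if t ≤ 1 then N.ropePath (2 - t) else if t ≤ 2 then N.loopPath (t - 1) else N.ropePath (t - 1)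

/-- A noose for the diagram `D`: the root misses `D`, and the loop and the rope are transverse to the
components of `D` and disjoint from the crossings. The neck is a corner of `ℓ_N`, where being
transverse means missing `D`. -/
structure IsFor {S : Type*} (N : Noose) (D : ColoredDiagram S) : Prop where
  root_notMem : N.root ∉ D.support
  neck_notMem : N.neck ∉ D.support
  loop_transverse : ∀ s ∈ Icc (0 : ℝ) 1, D.TransverseAt N.loopPath s
  rope_transverse : ∀ x ∈ Icc (1 : ℝ) 2, D.TransverseAt N.ropePath x

/-- `w` is the intersection word of the noose with `D`. -/
def IsIntersectionWord {S : Type*} (N : Noose) (D : ColoredDiagram S) (w : SignedWord S) : Prop :=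
  D.IsIntersectionWord N.path 0 3 w

end Noose

/-- An embedded arc in the plane. -/
def IsEmbeddedArc (A : Set ℂ) : Prop :=
  ∃ g : ℝ → ℂ, ContinuousOn g (Icc 0 1) ∧ InjOn g (Icc 0 1) ∧ g '' Icc 0 1 = A

/-- The noose `N` for the diagram `D` is proper. -/
structure Noose.IsProper {S : Type*} (N : Noose) (D : ColoredDiagram S) : Prop where
  /-- `D` meets the head in two embedded arcs that intersect each other in a single point. -/
  arcs : ∃ (A B : Set ℂ) (p : ℂ), IsEmbeddedArc A ∧ IsEmbeddedArc B ∧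
    D.support ∩ N.head = A ∪ B ∧ A ∩ B = {p}
  /-- Starting at the neck, the loop passes across `D` exactly four times: across a component `i`
  from left to right, across a component `j` from left to right, across `i` from right to left, and
  across `j` from right to left. -/
  passes : ∃ (i j : Fin D.n) (s₁ s₂ s₃ s₄ : ℝ),
    0 ≤ s₁ ∧ s₁ < s₂ ∧ s₂ < s₃ ∧ s₃ < s₄ ∧ s₄ ≤ 1 ∧
    (∀ s ∈ Icc (0 : ℝ) 1, N.loopPath s ∈ D.support ↔ s = s₁ ∨ s = s₂ ∨ s = s₃ ∨ s = s₄) ∧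
    D.PassesLeftToRight N.loopPath s₁ i ∧ D.PassesLeftToRight N.loopPath s₂ j ∧
    D.PassesRightToLeft N.loopPath s₃ i ∧ D.PassesRightToLeft N.loopPath s₄ j

/-- A noose system `(N₁, …, Nₘ)`: the nooses are disjoint except for their common root, the base
point, and their ropes appear counterclockwise in this order around it. For the second condition,
every sufficiently small circle about the base point is considered (a rope meets it exactly once); its
intersection points with the ropes have arguments `θ₁ < ⋯ < θₘ` within one turn. -/
structure NooseSystem (m : ℕ) where
  noose : Fin m → Noose
  base : ℂ
  root_eq : ∀ i, (noose i).root = base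
  disjoint : ∀ i j, i ≠ j → (noose i).image ∩ (noose j).image = {base}
  counterclockwise : ∀ᶠ r : ℝ in 𝓝[>] 0, ∃ θ : Fin m → ℝ,
    StrictMono θ ∧ (∀ i j, θ j < θ i + 2 * Real.pi) ∧
    ∀ i, base + r * Complex.exp (θ i * Complex.I) ∈ (noose i).rope

namespace NooseSystem

variable {m : ℕ} {S : Type*}

/-- A noose system for the diagram `D`: it consists of nooses for `D`, and every crossing of `D` is in
a head. -/
structure IsFor (N : NooseSystem m) (D : ColoredDiagram S) : Prop where
  noose_isFor : ∀ i, (N.noose i).IsFor D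
  crossings_subset : D.crossings ⊆ ⋃ i, (N.noose i).head

/-- A noose system is proper if each of its nooses is. -/
def IsProper (N : NooseSystem m) (D : ColoredDiagram S) : Prop :=
  ∀ i, (N.noose i).IsProper D

end NooseSystem

end Doodle

/-! Label the regions of the complement of the diagram by elements of the free group, multiplying on
the right by `a` when a component labelled `a` is passed from right to left. Away from the crossings
this is possible locally, uniquely up to left multiplication. These labellings are the sections of a
local system (`ColoredDiagram.localSystem`), and continuing one along a path multiplies it on the
right by the intersection word (`section_eq_mul_word`).

Continued once around a noose, from one side of the rope near the root to the other, a section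
changes by the word of the noose (`Noose.IsFor.exists_cut`). Declare the resulting cut functions to
be the sections on the nooses (`LocalSystem.modify`). As every crossing lies in a head, the new
local system has sections near every point except the base point. Pulled back along `ζ ↦ base + exp
ζ`, it has a section on a rectangle, whose monodromy is the same on all concentric circles. A large
circle meets neither diagram nor nooses, so the monodromy is trivial; a small one misses the diagram
and meets each rope once, which multiplies the section by `w₁ ⋯ wₘ`. Hence this product is trivial
(`NooseSystem.IsFor.prod_words`).

The shape of the words is read off directly: a rope with word `u` is run through backwards, then the
loop, then the rope forwards, and (P2) makes the loop word `(a, b)`. -/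

namespace Doodle

/-! ### Local systems -/

/-- A `G`-torsor of germs of `G`-valued functions: `Sec f x` says that `f` is a section near `x`. Two
sections near a point differ by left multiplication with a constant. -/
structure LocalSystem (X G : Type*) [TopologicalSpace X] [Group G] where
  Sec : (X → G) → X → Prop
  congr : ∀ {f f' x}, f =ᶠ[𝓝 x] f' → Sec f x → Sec f' x
  smul : ∀ {f x} (c : G), Sec f x → Sec (fun y => c * f y) x
  unique : ∀ {f f' x}, Sec f x → Sec f' x → ∃ c, ∀ᶠ y in 𝓝 x, f' y = c * f y
  eventually : ∀ {f x}, Sec f x → ∀ᶠ y in 𝓝 x, Sec f y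

/-- Induction over a compact interval for a property of subintervals that holds for all short
subintervals and passes to the union of adjacent ones. -/
theorem Icc_induction {P : ℝ → ℝ → Prop} {a b : ℝ} (hab : a ≤ b)
    (loc : ∀ x ∈ Icc a b, ∃ ε > 0, ∀ u ∈ Icc a b, ∀ v ∈ Icc a b,
      x - ε < u → u ≤ v → v < x + ε → P u v)
    (trans : ∀ u v w, P u v → P v w → P u w) : P a b := by
  obtain ⟨ε₀, hε₀, h₀⟩ := loc a ⟨le_rfl, hab⟩
  set T : Set ℝ := {x | x ∈ Icc a b ∧ P a x} with hT
  have haT : a ∈ T := ⟨⟨le_rfl, hab⟩, h₀ a ⟨le_rfl, hab⟩ a ⟨le_rfl, hab⟩ (by linarith) le_rfl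
    (by linarith)⟩
  have hbdd : BddAbove T := ⟨b, fun x hx => hx.1.2⟩
  have hs : sSup T ∈ Icc a b := ⟨le_csSup hbdd haT, csSup_le ⟨a, haT⟩ fun x hx => hx.1.2⟩
  obtain ⟨ε, hε, h⟩ := loc _ hs
  obtain ⟨x, hxT, hx⟩ := exists_lt_of_lt_csSup ⟨a, haT⟩ (show sSup T - ε < sSup T by linarith)
  have hxs : x ≤ sSup T := le_csSup hbdd hxT
  have key : ∀ v ∈ Icc a b, x ≤ v → v < sSup T + ε → P a v := fun v hv hxv hv' =>
    trans _ _ _ hxT.2 (h x hxT.1 v hv hx hxv hv')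
  -- If `b` were not reached, `sSup T + ε / 2` would be an element of `T` beyond its supremum.
  by_contra hne
  have hlt : sSup T + ε ≤ b := by
    by_contra hcon
    exact hne (key b ⟨hab, le_rfl⟩ (hxs.trans hs.2) (by linarith))
  have hmem : sSup T + ε / 2 ∈ T :=
    ⟨⟨by linarith [hs.1], by linarith⟩,
      key _ ⟨by linarith [hs.1], by linarith⟩ (by linarith) (by linarith)⟩
  linarith [le_csSup hbdd hmem]

namespace LocalSystem

variable {X Y G : Type*} [TopologicalSpace X] [TopologicalSpace Y] [Group G] (L : LocalSystem X G)

/-- The pull-back of a local system. -/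
def comap (p : Y → X) : LocalSystem Y G where
  -- Continuity is part of the condition because noose maps are controlled only near their model;
  -- asking for it in a neighbourhood keeps `Sec` an open condition.
  Sec f y := (∀ᶠ y' in 𝓝 y, ContinuousAt p y') ∧ ∃ f₀, L.Sec f₀ (p y) ∧ f =ᶠ[𝓝 y] f₀ ∘ p
  congr := by
    rintro f f' y h ⟨hc, f₀, h₀, hf⟩
    exact ⟨hc, f₀, h₀, h.symm.trans hf⟩
  smul := by
    rintro f y c ⟨hc, f₀, h₀, hf⟩
    refine ⟨hc, _, L.smul c h₀, ?_⟩
    filter_upwards [hf] with z hz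
    simp [hz]
  unique := by
    rintro f f' y ⟨hc, f₀, h₀, hf⟩ ⟨-, f₁, h₁, hf'⟩
    obtain ⟨c, hc'⟩ := L.unique h₀ h₁
    refine ⟨c, ?_⟩
    filter_upwards [hf, hf', hc.self_of_nhds.eventually hc'] with z h1 h2 h3
    simp only [h1, h2, Function.comp_apply, h3]
  eventually := by
    rintro f y ⟨hc, f₀, h₀, hf⟩
    filter_upwards [hc.eventually_nhds, hc.self_of_nhds.eventually (L.eventually h₀),
      hf.eventuallyEq_nhds] with z h1 h2 h3
    exact ⟨h1, f₀, h2, h3⟩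

/-- Local uniqueness makes `f' y * (f y)⁻¹` locally constant on `s`, hence constant, even though `f`
and `f'` may jump. -/
theorem unique_of_isPreconnected {f f' : X → G} {s : Set X} (hs : IsPreconnected s)
    (hf : ∀ x ∈ s, L.Sec f x) (hf' : ∀ x ∈ s, L.Sec f' x) :
    ∃ c, ∀ x ∈ s, ∀ᶠ y in 𝓝 x, f' y = c * f y := by
  rcases s.eq_empty_or_nonempty with rfl | ⟨x₀, hx₀⟩
  · exact ⟨1, by simp⟩
  have hloc : ∀ x ∈ s, ∀ᶠ y in 𝓝[s] x, f' y * (f y)⁻¹ = f' x * (f x)⁻¹ := by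
    intro x hx
    obtain ⟨c, hc⟩ := L.unique (hf x hx) (hf' x hx)
    have h0 := hc.self_of_nhds
    filter_upwards [mem_nhdsWithin_of_mem_nhds hc] with y hy
    rw [h0, show f' y = c * f y from hy]
    group
  refine ⟨f' x₀ * (f x₀)⁻¹, fun x hx => ?_⟩
  have hconst : f' x * (f x)⁻¹ = f' x₀ * (f x₀)⁻¹ :=
    hs.induction₂ (fun x y => f' y * (f y)⁻¹ = f' x * (f x)⁻¹)
      hloc (fun _ _ _ _ _ _ h1 h2 => h2.trans h1) (fun _ _ _ _ h => h.symm) hx₀ hx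
  obtain ⟨c, hc⟩ := L.unique (hf x hx) (hf' x hx)
  have h0 := hc.self_of_nhds
  filter_upwards [hc] with y hy
  rw [hy, ← hconst, h0]
  group

/-- Gluing of sections along a level set of a continuous function. -/
theorem exists_glue {u : X → ℝ} (hu : Continuous u) (t : ℝ) {s : Set X}
    (hs : IsPreconnected (s ∩ {x | u x = t})) {f f' : X → G}
    (hf : ∀ x ∈ s, u x ≤ t → L.Sec f x) (hf' : ∀ x ∈ s, t ≤ u x → L.Sec f' x) :
    ∃ h, ∀ x ∈ s, L.Sec h x := by
  -- One constant matches `c * f'` with `f` in full neighbourhoods of all points of the level set;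
  -- this is where its preconnectedness enters.
  obtain ⟨c, hc⟩ := L.unique_of_isPreconnected hs (f := f') (f' := f)
    (fun x hx => hf' x hx.1 (le_of_eq hx.2.symm)) (fun x hx => hf x hx.1 (le_of_eq hx.2))
  classical
  refine ⟨fun x => if u x ≤ t then f x else c * f' x, fun x hx => ?_⟩
  rcases lt_trichotomy (u x) t with h | h | h
  · refine L.congr ?_ (hf x hx h.le)
    filter_upwards [hu.continuousAt.eventually (gt_mem_nhds h)] with y hy
    rw [if_pos (le_of_lt hy)]
  · refine L.congr ?_ (hf x hx h.le)
    filter_upwards [hc x ⟨hx, h⟩] with y hy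
    split_ifs
    · rfl
    · exact hy
  · refine L.congr ?_ (L.smul c (hf' x hx h.le))
    filter_upwards [hu.continuousAt.eventually (lt_mem_nhds h)] with y hy
    rw [if_neg (not_le.2 hy)]

theorem isPreconnected_reProdIm {s t : Set ℝ} (hs : Convex ℝ s) (ht : Convex ℝ t) :
    IsPreconnected (s ×ℂ t) := by
  refine Convex.isPreconnected ?_
  exact (hs.linear_preimage Complex.reLm).inter (ht.linear_preimage Complex.imLm)

/-- A local system over a compact rectangle has a section. -/
theorem exists_section_rectangle (L : LocalSystem ℂ G) {a b c d : ℝ} (hab : a ≤ b) (hcd : c ≤ d)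
    (hL : ∀ z ∈ Icc a b ×ℂ Icc c d, ∃ f, L.Sec f z) :
    ∃ f, ∀ z ∈ Icc a b ×ℂ Icc c d, L.Sec f z := by
  -- Sections over vertical segments are built first. By compactness each is a section over a strip,
  -- and the strips are glued in turn.
  have vert : ∀ x ∈ Icc a b, ∃ f, ∀ z ∈ ({x} : Set ℝ) ×ℂ Icc c d, L.Sec f z := by
    intro x hx
    refine Icc_induction (P := fun u v => ∃ f, ∀ z ∈ ({x} : Set ℝ) ×ℂ Icc u v, L.Sec f z) hcd ?_ ?_
    · intro y hy
      obtain ⟨f, hf⟩ := hL ⟨x, y⟩ ⟨hx, hy⟩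
      obtain ⟨ε, hε, hball⟩ := Metric.eventually_nhds_iff_ball.1 (L.eventually hf)
      refine ⟨ε, hε, fun u _ v _ hu huv hv => ⟨f, fun z hz => hball z ?_⟩⟩
      obtain ⟨h1, h2⟩ := hz
      simp only [mem_preimage, mem_singleton_iff, mem_Icc] at h1 h2
      rw [Metric.mem_ball, Complex.dist_of_re_eq h1, Real.dist_eq, abs_lt]
      constructor <;> simp only <;> linarith [h2.1, h2.2]
    · rintro u v w ⟨f, hf⟩ ⟨f', hf'⟩
      refine L.exists_glue Complex.continuous_im v (s := ({x} : Set ℝ) ×ℂ Icc u w) ?_ (f := f)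
        (f' := f') ?_ ?_
      · have : ({x} : Set ℝ) ×ℂ Icc u w ∩ {z | z.im = v} = {x} ×ℂ (Icc u w ∩ {v}) := by
          ext z; simp [Complex.mem_reProdIm, and_assoc]
        rw [this]
        exact isPreconnected_reProdIm (convex_singleton _) ((convex_Icc _ _).inter
          (convex_singleton _))
      · exact fun z hz h => hf z ⟨hz.1, hz.2.1, h⟩
      · exact fun z hz h => hf' z ⟨hz.1, h, hz.2.2⟩
  refine Icc_induction (P := fun u v => ∃ f, ∀ z ∈ Icc u v ×ℂ Icc c d, L.Sec f z) hab ?_ ?_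
  · intro x hx
    obtain ⟨f, hf⟩ := vert x hx
    have hev : ∀ᶠ x' in 𝓝 x, ∀ y ∈ Icc c d, L.Sec f ⟨x', y⟩ := by
      refine isCompact_Icc.eventually_forall_of_forall_eventually fun y hy => ?_
      have hcont : Tendsto (fun q : ℝ × ℝ => (⟨q.1, q.2⟩ : ℂ)) (𝓝 (x, y)) (𝓝 ⟨x, y⟩) := by
        have : Continuous fun q : ℝ × ℝ => (⟨q.1, q.2⟩ : ℂ) :=
          Complex.equivRealProdCLM.symm.continuous
        exact this.tendsto _
      exact hcont.eventually (L.eventually (hf ⟨x, y⟩ ⟨rfl, hy⟩))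
    obtain ⟨ε, hε, hball⟩ := Metric.eventually_nhds_iff_ball.1 hev
    refine ⟨ε, hε, fun u _ v _ hu huv hv => ⟨f, fun z hz => hball z.re ?_ z.im hz.2⟩⟩
    have := hz.1
    simp only [mem_preimage, mem_Icc] at this
    rw [Metric.mem_ball, Real.dist_eq, abs_lt]
    constructor <;> linarith
  · rintro u v w ⟨f, hf⟩ ⟨f', hf'⟩
    refine L.exists_glue Complex.continuous_re v (s := Icc u w ×ℂ Icc c d) ?_ (f := f)
      (f' := f') ?_ ?_
    · have : Icc u w ×ℂ Icc c d ∩ {z | z.re = v} = (Icc u w ∩ {v}) ×ℂ Icc c d := by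
        ext z; simp only [Complex.mem_reProdIm, mem_inter_iff, mem_ofPred_eq, mem_singleton_iff]
        tauto
      rw [this]
      exact isPreconnected_reProdIm ((convex_Icc _ _).inter (convex_singleton _)) (convex_Icc _ _)
    · exact fun z hz h => hf z ⟨⟨hz.1.1, h⟩, hz.2⟩
    · exact fun z hz h => hf' z ⟨⟨h, hz.1.2⟩, hz.2⟩

end LocalSystem

/-! ### Jumps of functions of a real variable -/

/-- Near `t` the function `H` is constant on both sides, and multiplied by `g` on the right when `t`
is passed. -/
def JumpsAt {G : Type*} [Group G] (H : ℝ → G) (t : ℝ) (g : G) : Prop :=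
  ∃ c, (∀ᶠ s in 𝓝[<] t, H s = c) ∧ ∀ᶠ s in 𝓝[>] t, H s = c * g

section Jumps

variable {G : Type*} [Group G] {H : ℝ → G}

theorem JumpsAt.congr_mul {H' : ℝ → G} {t : ℝ} {g : G} (h : JumpsAt H t g) (c : G)
    (hH : ∀ᶠ s in 𝓝[≠] t, H' s = c * H s) : JumpsAt H' t g := by
  obtain ⟨c', h1, h2⟩ := h
  refine ⟨c * c', ?_, ?_⟩
  · filter_upwards [h1, nhdsLT_le_nhdsNE t hH] with s hs hs'
    rw [hs', hs]
  · filter_upwards [h2, nhdsGT_le_nhdsNE t hH] with s hs hs'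
    rw [hs', hs, mul_assoc]

theorem eq_of_locally_constant {G : Type*} {H : ℝ → G} {a b : ℝ} (hab : a ≤ b)
    (h : ∀ t ∈ Icc a b, ∃ c, ∀ᶠ s in 𝓝 t, H s = c) : H b = H a := by
  refine Icc_induction (P := fun u v => H v = H u) hab ?_ fun u v w h1 h2 => h2.trans h1
  intro x hx
  obtain ⟨c, hc⟩ := h x hx
  obtain ⟨ε, hε, hball⟩ := Metric.eventually_nhds_iff_ball.1 hc
  refine ⟨ε, hε, fun u _ v _ hu huv hv => ?_⟩
  rw [hball u, hball v] <;> rw [Metric.mem_ball, Real.dist_eq, abs_lt] <;> constructor <;> linarith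

/-- `H` is constant between jumps, and each jump multiplies on the right, so the factors appear in
the order of time. The induction moves the left end point just past the first jump. -/
theorem eq_mul_prod_of_jumps {ts : List ℝ} {gs : List G} (hj : List.Forall₂ (JumpsAt H) ts gs)
    {a b : ℝ} (hab : a ≤ b) (hts : ts.Pairwise (· < ·)) (hmem : ∀ t ∈ ts, t ∈ Ioo a b)
    (h : ∀ t ∈ Icc a b, t ∉ ts → ∃ c, ∀ᶠ s in 𝓝 t, H s = c) : H b = H a * gs.prod := by
  induction hj generalizing a with
  | nil => simpa using eq_of_locally_constant hab fun t ht => h t ht (by simp)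
  | @cons t g ts gs htg hj ih =>
    rw [List.pairwise_cons] at hts
    have ht := hmem t (by simp)
    obtain ⟨c, hl, hr⟩ := htg
    obtain ⟨a₁, ha₁c, haa₁, ha₁⟩ := (hl.and (Ioo_mem_nhdsLT ht.1)).exists
    have hev : ∀ᶠ s in 𝓝[>] t, ∀ t' ∈ ts, s < t' :=
      (eventually_all_finite ts.finite_toSet).2 fun t' ht' =>
        mem_nhdsWithin_of_mem_nhds (Iio_mem_nhds (hts.1 t' ht'))
    obtain ⟨a₂, ha₂c, ha₂, ha₂'⟩ := (hr.and (Eventually.and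
      (show ∀ᶠ s in 𝓝[>] t, s ∈ Ioo t b from Ioo_mem_nhdsGT ht.2) hev)).exists
    have h1 : H a₁ = H a := eq_of_locally_constant haa₁.le fun x hx => h x
      ⟨hx.1, by linarith [hx.2, ht.2]⟩ (by
        intro hmem'
        rcases List.mem_cons.1 hmem' with rfl | h'
        · linarith [hx.2]
        · linarith [hx.2, hts.1 x h'])
    rw [ih ha₂.2.le hts.2 (fun t' ht' => ⟨ha₂' t' ht', (hmem t' (by simp [ht'])).2⟩)
      (fun x hx hxt => h x ⟨by linarith [hx.1, ha₂.1, ht.1], hx.2⟩ (by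
        intro hmem'
        rcases List.mem_cons.1 hmem' with rfl | h'
        · linarith [hx.1, ha₂.1]
        · exact hxt h')), ha₂c, ← ha₁c, h1, List.prod_cons, mul_assoc]

end Jumps

namespace ColoredDiagram

variable {S : Type*} (D : ColoredDiagram S)

/-! ### The local system of a diagram -/

theorem crossings_subset_support : D.crossings ⊆ D.support := by
  rintro p ⟨i, _, s, _, _, _, _, h, _⟩
  exact ⟨i, s, h⟩

theorem curve_add_int (i : Fin D.n) (t : ℝ) (n : ℤ) : D.curve i (t + n) = D.curve i t := by
  simpa using (D.periodic i).int_mul n t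

theorem deriv_curve_add_int (i : Fin D.n) (t : ℝ) (n : ℤ) :
    deriv (D.curve i) (t + n) = deriv (D.curve i) t := by
  rw [← deriv_comp_add_const]
  congr 1
  ext x
  exact D.curve_add_int i x n

theorem isCompact_image (i : Fin D.n) {T : Set ℝ} (hT : IsCompact T) :
    IsCompact (D.curve i '' T) :=
  hT.image (D.smooth i).continuous

/-- Centring the period at `s` keeps `s` away from its ends. -/
theorem exists_int_add_mem (s t : ℝ) : ∃ n : ℤ, t + n ∈ Icc (s - 1 / 2) (s + 1 / 2) := by
  refine ⟨-round (t - s), ?_⟩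
  have := abs_le.1 (abs_sub_round (t - s))
  push_cast
  constructor <;> linarith [this.1, this.2]

/-- Two passages with different fractional parts or on different components would make the point a
crossing. -/
theorem eq_of_notMem_crossings {z : ℂ} (hz : z ∉ D.crossings) {i j : Fin D.n} {s t : ℝ}
    (hs : D.curve i s = z) (ht : D.curve j t = z) : j = i ∧ ∃ n : ℤ, t + n = s := by
  have hfract : ∀ (k : Fin D.n) (x : ℝ), D.curve k (Int.fract x) = D.curve k x := by
    intro k x
    have := D.curve_add_int k x (-⌊x⌋)
    rwa [Int.cast_neg, ← sub_eq_add_neg] at this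
  by_contra hne
  refine hz ⟨i, j, Int.fract s, ⟨Int.fract_nonneg _, Int.fract_lt_one _⟩, Int.fract t,
    ⟨Int.fract_nonneg _, Int.fract_lt_one _⟩, ?_, (hfract i s).trans hs, (hfract j t).trans ht⟩
  intro heq
  rw [Prod.mk.injEq] at heq
  obtain ⟨n, hn⟩ := Int.fract_eq_fract.1 heq.2
  exact hne ⟨heq.1.symm, n, by rw [← hn]; ring⟩

/-- Near a point that is passed only once, the diagram is passed only near the time of the
passage. -/
theorem eventually_passage {z : ℂ} (hz : z ∉ D.crossings) {i : Fin D.n} {s : ℝ}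
    (hs : D.curve i s = z) {T : Set ℝ} (hT : T ∈ 𝓝 s) :
    ∀ᶠ y in 𝓝 z, ∀ j t, D.curve j t = y → j = i ∧ ∃ n : ℤ, t + n ∈ T := by
  obtain ⟨V, hVT, hV, hsV⟩ := mem_nhds_iff.1 hT
  have key : ∀ j, ∀ᶠ y in 𝓝 z, ∀ t, D.curve j t = y → j = i ∧ ∃ n : ℤ, t + n ∈ T := by
    intro j
    -- The passages of one period outside the allowed times form a compact set that misses `z`,
    -- hence a neighbourhood of `z`.
    have hcomp : IsCompact (D.curve j '' (Icc (s - 1 / 2) (s + 1 / 2) \ {t | j = i ∧ t ∈ V})) := by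
      refine D.isCompact_image j (isCompact_Icc.diff ?_)
      by_cases h : j = i
      · simpa [h] using hV
      · simp [h]
    have hzn : z ∉ D.curve j '' (Icc (s - 1 / 2) (s + 1 / 2) \ {t | j = i ∧ t ∈ V}) := by
      rintro ⟨t, ⟨ht, htV⟩, htz⟩
      obtain ⟨hj, n, hn⟩ := D.eq_of_notMem_crossings hz hs htz
      refine htV ⟨hj, ?_⟩
      rcases eq_or_ne n 0 with rfl | hn0
      · simp only [Int.cast_zero, add_zero] at hn
        rwa [hn]
      · exfalso
        have h1 : (1 : ℝ) ≤ |(n : ℝ)| := by exact_mod_cast Int.one_le_abs hn0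
        have h2 : (n : ℝ) = s - t := by linarith
        rw [h2] at h1
        have h3 : |s - t| ≤ 1 / 2 := abs_le.2 ⟨by linarith [ht.2], by linarith [ht.1]⟩
        linarith
    filter_upwards [hcomp.isClosed.isOpen_compl.mem_nhds hzn] with y hy t hty
    obtain ⟨n, hn⟩ := exists_int_add_mem s t
    by_contra hcon
    refine hy ⟨t + n, ⟨hn, fun h => hcon ⟨h.1, n, hVT h.2⟩⟩, ?_⟩
    rw [D.curve_add_int, hty]
  exact eventually_all.2 key

theorem isCompact_support : IsCompact D.support := by
  have : D.support = ⋃ i, D.curve i '' Icc (0 - 1 / 2) (0 + 1 / 2) := by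
    ext z
    simp only [support, mem_ofPred_eq, mem_iUnion]
    constructor
    · rintro ⟨i, t, rfl⟩
      obtain ⟨n, hn⟩ := exists_int_add_mem 0 t
      exact ⟨i, _, hn, D.curve_add_int i t n⟩
    · rintro ⟨i, t, -, rfl⟩
      exact ⟨i, t, rfl⟩
  rw [this]
  exact isCompact_iUnion fun i => D.isCompact_image i isCompact_Icc

theorem eventually_notMem_support {z : ℂ} (hz : z ∉ D.support) : ∀ᶠ y in 𝓝 z, y ∉ D.support :=
  D.isCompact_support.isClosed.isOpen_compl.mem_nhds hz

/-! ### Tubular charts along a component -/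

/-- The tubular map of a component: `x + y i` is mapped to the point at distance `y` to the left of
the point at time `x`, measured in units of the speed. -/
noncomputable def tube (i : Fin D.n) (ξ : ℂ) : ℂ :=
  D.curve i ξ.re + ξ.im * Complex.I * deriv (D.curve i) ξ.re

@[simp] theorem tube_ofReal (i : Fin D.n) (s : ℝ) : D.tube i s = D.curve i s := by simp [tube]

theorem tube_add_int (i : Fin D.n) (ξ : ℂ) (n : ℤ) : D.tube i (ξ + n) = D.tube i ξ := by
  simp [tube, D.curve_add_int, D.deriv_curve_add_int]

theorem contDiff_deriv_curve (i : Fin D.n) : ContDiff ℝ ∞ (deriv (D.curve i)) :=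
  (contDiff_infty_iff_deriv.1 (D.smooth i)).2

theorem contDiff_tube (i : Fin D.n) : ContDiff ℝ ∞ (D.tube i) := by
  have hre : ContDiff ℝ ∞ Complex.re := Complex.reCLM.contDiff
  have him : ContDiff ℝ ∞ fun z : ℂ => (z.im : ℂ) :=
    (Complex.ofRealCLM.comp Complex.imCLM).contDiff
  exact ((D.smooth i).comp hre).add ((him.mul contDiff_const).mul
    ((D.contDiff_deriv_curve i).comp hre))

/-- Multiplication with a nonzero complex number. -/
noncomputable def mulEquiv (v : ℂ) (hv : v ≠ 0) : ℂ ≃L[ℝ] ℂ :=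
  (ContinuousLinearEquiv.unitsEquivAut ℂ (Units.mk0 v hv)).restrictScalars ℝ

theorem mulEquiv_apply (v : ℂ) (hv : v ≠ 0) (w : ℂ) : mulEquiv v hv w = w * v := rfl

/-- On the real axis the differential is complex multiplication by the velocity. It is invertible by
immersedness and preserves orientation, so the left side of the component corresponds to positive
imaginary part. -/
theorem hasStrictFDerivAt_tube (i : Fin D.n) (s : ℝ) :
    HasStrictFDerivAt (D.tube i)
      (mulEquiv (deriv (D.curve i) s) (D.immersed i s) : ℂ →L[ℝ] ℂ) s := by
  refine (D.contDiff_tube i).contDiffAt.hasStrictFDerivAt' ?_ (by simp)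
  have h1 : HasFDerivAt (fun ξ : ℂ => D.curve i ξ.re) _ (s : ℂ) :=
    (((D.smooth i).differentiable (by simp) _).hasDerivAt (x := (s : ℂ).re)).hasFDerivAt.comp
      (s : ℂ) Complex.reCLM.hasFDerivAt
  have h2 : HasFDerivAt (fun ξ : ℂ => deriv (D.curve i) ξ.re) _ (s : ℂ) :=
    (((D.contDiff_deriv_curve i).differentiable (by simp) _).hasDerivAt
      (x := (s : ℂ).re)).hasFDerivAt.comp (s : ℂ) Complex.reCLM.hasFDerivAt
  have h3 : HasFDerivAt (fun ξ : ℂ => (ξ.im : ℂ) * Complex.I) _ (s : ℂ) :=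
    ((Complex.ofRealCLM.comp Complex.imCLM).hasFDerivAt (x := (s : ℂ))).mul_const' Complex.I
  refine (h1.add (h3.mul h2)).congr_fderiv ?_
  ext x
  simp [mulEquiv_apply]
  linear_combination deriv (D.curve i) s * Complex.re_add_im x

theorem exists_tube_chart (i : Fin D.n) (s : ℝ) :
    ∃ e : OpenPartialHomeomorph ℂ ℂ, ⇑e = D.tube i ∧ (s : ℂ) ∈ e.source ∧
      e.symm (D.curve i s) = s ∧
      ∀ {α : ℝ → ℂ} {t : ℝ} {v : ℂ}, HasDerivAt α v t → α t = D.curve i s →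
        HasDerivAt (fun x => e.symm (α x)) (v / deriv (D.curve i) s) t := by
  have h := D.hasStrictFDerivAt_tube i s
  have hinv : h.localInverse (D.tube i) _ _ (D.curve i s) = s := by
    rw [← D.tube_ofReal]; exact h.localInverse_apply_image
  refine ⟨h.toOpenPartialHomeomorph (D.tube i), rfl, h.mem_toOpenPartialHomeomorph_source, hinv, ?_⟩
  intro α t v hα hαt
  have h' := h.to_localInverse.hasFDerivAt
  rw [D.tube_ofReal, ← hαt] at h'
  have := h'.comp_hasDerivAt t hα
  have hv : (mulEquiv _ (D.immersed i s)).symm v = v / deriv (D.curve i) s := by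
    rw [eq_div_iff (D.immersed i s), ← mulEquiv_apply _ (D.immersed i s)]
    exact (mulEquiv _ (D.immersed i s)).apply_symm_apply v
  rw [← hv]
  exact this

/-! ### Sections of the local system -/

/-- The section on a tubular neighbourhood of a component: trivial on the right, the label on the
left. -/
noncomputable def step (i : Fin D.n) (ξ : ℂ) : FreeGroup S :=
  open Classical in if 0 ≤ ξ.im then FreeGroup.of (D.label i) else 1

theorem step_add_int (i : Fin D.n) (ξ : ℂ) (n : ℤ) : D.step i (ξ + n) = D.step i ξ := by
  simp [step]

/-- `f` is locally constant near `z` except for jumps across the diagram, where it is multiplied by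
the label on the right when the component is passed from its right to its left. -/
def IsSectionAt (f : ℂ → FreeGroup S) (z : ℂ) : Prop :=
  (z ∉ D.support ∧ ∃ c, ∀ᶠ y in 𝓝 z, f y = c) ∨
    (z ∉ D.crossings ∧ ∃ i s, D.curve i s = z ∧
      ∃ c, ∀ᶠ ξ in 𝓝 (s : ℂ), f (D.tube i ξ) = c * D.step i ξ)

variable {D}

theorem IsSectionAt.notMem_crossings {f : ℂ → FreeGroup S} {z : ℂ} (h : D.IsSectionAt f z) :
    z ∉ D.crossings :=
  h.elim (fun h => fun hz => h.1 (D.crossings_subset_support hz)) fun h => h.1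

theorem IsSectionAt.exists_eventually_eq {f : ℂ → FreeGroup S} {z : ℂ} (h : D.IsSectionAt f z)
    (hz : z ∉ D.support) : ∃ c, ∀ᶠ y in 𝓝 z, f y = c := by
  rcases h with h | ⟨-, i, s, h, -⟩
  · exact h.2
  · exact absurd ⟨i, s, h⟩ hz

/-- The parameter of the passage is unique up to integers, under which `tube` and `step` are
invariant, so any parameter will do. -/
theorem IsSectionAt.exists_eventually_tube {f : ℂ → FreeGroup S} {z : ℂ} (h : D.IsSectionAt f z)
    {i : Fin D.n} {s : ℝ} (hs : D.curve i s = z) :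
    ∃ c, ∀ᶠ ξ in 𝓝 (s : ℂ), f (D.tube i ξ) = c * D.step i ξ := by
  rcases h with h | ⟨hz, j, t, ht, c, hc⟩
  · exact absurd ⟨i, s, hs⟩ h.1
  · obtain ⟨rfl, n, hn⟩ := D.eq_of_notMem_crossings hz ht hs
    refine ⟨c, ?_⟩
    have : Tendsto (fun ξ : ℂ => ξ + n) (𝓝 (s : ℂ)) (𝓝 (t : ℂ)) := by
      rw [← hn]; push_cast
      exact (continuous_add_const (n : ℂ)).tendsto _
    filter_upwards [this.eventually hc] with ξ hξ
    rwa [D.tube_add_int, D.step_add_int] at hξ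

theorem map_tube_nhds (i : Fin D.n) (s : ℝ) : map (D.tube i) (𝓝 (s : ℂ)) = 𝓝 (D.curve i s) := by
  rw [← D.tube_ofReal]
  exact (D.hasStrictFDerivAt_tube i s).map_nhds_eq_of_equiv

theorem IsSectionAt.unique {f f' : ℂ → FreeGroup S} {z : ℂ} (h : D.IsSectionAt f z)
    (h' : D.IsSectionAt f' z) : ∃ c, ∀ᶠ y in 𝓝 z, f' y = c * f y := by
  by_cases hz : z ∈ D.support
  · obtain ⟨i, s, rfl⟩ := hz
    obtain ⟨c, hc⟩ := h.exists_eventually_tube rfl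
    obtain ⟨c', hc'⟩ := h'.exists_eventually_tube rfl
    refine ⟨c' * c⁻¹, ?_⟩
    rw [← map_tube_nhds, eventually_map]
    filter_upwards [hc, hc'] with ξ h1 h2
    rw [h1, h2]; group
  · obtain ⟨c, hc⟩ := h.exists_eventually_eq hz
    obtain ⟨c', hc'⟩ := h'.exists_eventually_eq hz
    refine ⟨c' * c⁻¹, ?_⟩
    filter_upwards [hc, hc'] with y h1 h2
    rw [h1, h2]; group

/-- In a tubular chart around a point that is passed only once, exactly the real points belong to the
diagram, and they are no crossings. -/
theorem eventually_tube_mem_support {i : Fin D.n} {s : ℝ} (hs : D.curve i s ∉ D.crossings) :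
    ∀ᶠ ξ in 𝓝 (s : ℂ), (D.tube i ξ ∈ D.support → ξ.im = 0) ∧ D.tube i ξ ∉ D.crossings := by
  obtain ⟨e, he, hse, -⟩ := D.exists_tube_chart i s
  have hT : {t : ℝ | (t : ℂ) ∈ e.source} ∈ 𝓝 s :=
    Complex.continuous_ofReal.continuousAt.preimage_mem_nhds (e.open_source.mem_nhds hse)
  have hev := D.eventually_passage hs rfl hT
  rw [← map_tube_nhds, eventually_map] at hev
  filter_upwards [hev, e.open_source.mem_nhds hse] with ξ hξ hξe
  have key : ∀ j t, D.curve j t = D.tube i ξ → j = i ∧ ∃ n : ℤ, ((t + n : ℝ) : ℂ) = ξ := by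
    intro j t ht
    obtain ⟨rfl, n, hn⟩ := hξ j t ht
    refine ⟨rfl, n, e.injOn hn hξe ?_⟩
    rw [he, D.tube_ofReal, D.curve_add_int, ht]
  constructor
  · rintro ⟨j, t, ht⟩
    obtain ⟨-, n, hn⟩ := key j t ht
    rw [← hn, Complex.ofReal_im]
  -- Both parameters agree with `ξ` up to integers, hence with each other in `[0, 1)`.
  · rintro ⟨j, k, t, ht, t', ht', hne, h1, h2⟩
    obtain ⟨rfl, n, hn⟩ := key j t h1
    obtain ⟨rfl, n', hn'⟩ := key k t' h2
    refine hne (Prod.ext rfl ?_)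
    have h3 : t + n = t' + n' := by
      have := hn.trans hn'.symm
      exact_mod_cast this
    have h4 := Int.fract_add_intCast t n
    rw [h3, Int.fract_add_intCast, Int.fract_eq_self.2 ht, Int.fract_eq_self.2 ht'] at h4
    exact h4.symm

/-- In a tubular chart, nearby real points are passages of the same component with the same constant
`c`; off the real axis `step` is locally constant. -/
theorem IsSectionAt.eventually {f : ℂ → FreeGroup S} {z : ℂ} (h : D.IsSectionAt f z) :
    ∀ᶠ y in 𝓝 z, D.IsSectionAt f y := by
  by_cases hz : z ∈ D.support
  · obtain ⟨i, s, rfl⟩ := hz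
    obtain ⟨c, hc⟩ := h.exists_eventually_tube rfl
    obtain ⟨e, he, hse, -⟩ := D.exists_tube_chart i s
    rw [← map_tube_nhds, eventually_map]
    filter_upwards [hc.eventually_nhds, eventually_tube_mem_support h.notMem_crossings,
      e.open_source.mem_nhds hse] with ξ h1 h2 hξe
    by_cases hξ : ξ.im = 0
    · right
      have hξr : (ξ.re : ℂ) = ξ := Complex.ext rfl hξ.symm
      refine ⟨h2.2, i, ξ.re, ?_, c, ?_⟩
      · rw [← D.tube_ofReal, hξr]
      · rwa [hξr]
    · left
      refine ⟨fun hcon => hξ (h2.1 hcon), c * D.step i ξ, ?_⟩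
      rw [← he, ← e.map_nhds_eq hξe, eventually_map, he]
      have hstep : ∀ᶠ ζ in 𝓝 ξ, D.step i ζ = D.step i ξ := by
        rcases lt_or_gt_of_ne hξ with hlt | hgt
        · filter_upwards [Complex.continuous_im.continuousAt.eventually (gt_mem_nhds hlt)] with ζ hζ
          simp only [step, if_neg (not_le.2 hlt), if_neg (not_le.2 hζ)]
        · filter_upwards [Complex.continuous_im.continuousAt.eventually (lt_mem_nhds hgt)] with ζ hζ
          simp only [step, if_pos hgt.le, if_pos hζ.le]
      filter_upwards [h1, hstep] with ζ h3 h4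
      rw [h3, h4]
  · filter_upwards [D.eventually_notMem_support hz,
      (h.exists_eventually_eq hz).choose_spec.eventually_nhds] with y h1 h2
    exact Or.inl ⟨h1, _, h2⟩

variable (D) in
/-- The local system of a diagram on the complement of the crossings. -/
def localSystem : LocalSystem ℂ (FreeGroup S) where
  Sec := D.IsSectionAt
  congr := by
    rintro f f' z h (⟨hz, c, hc⟩ | ⟨hz, i, s, hs, c, hc⟩)
    · exact Or.inl ⟨hz, c, hc.congr (h.mono fun y hy => by rw [hy])⟩
    · refine Or.inr ⟨hz, i, s, hs, c, hc.congr ?_⟩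
      rw [← hs, ← map_tube_nhds] at h
      exact (eventually_map.1 h).mono fun y hy => by rw [hy]
  smul := by
    rintro f z g (⟨hz, c, hc⟩ | ⟨hz, i, s, hs, c, hc⟩)
    · exact Or.inl ⟨hz, g * c, hc.mono fun y hy => by simp only [hy]⟩
    · exact Or.inr ⟨hz, i, s, hs, g * c, hc.mono fun y hy => by simp only [hy, mul_assoc]⟩
  unique := IsSectionAt.unique
  eventually := IsSectionAt.eventually

theorem exists_isSectionAt {z : ℂ} (hz : z ∉ D.crossings) : ∃ f, D.IsSectionAt f z := by
  by_cases hs : z ∈ D.support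
  · obtain ⟨i, s, rfl⟩ := hs
    obtain ⟨e, he, hse, -⟩ := D.exists_tube_chart i s
    refine ⟨fun y => D.step i (e.symm y), Or.inr ⟨hz, i, s, rfl, 1, ?_⟩⟩
    filter_upwards [e.eventually_left_inverse hse] with ξ hξ
    rw [he] at hξ
    rw [hξ, one_mul]
  · exact ⟨fun _ => 1, Or.inl ⟨hs, 1, by simp⟩⟩

/-! ### Sections along paths -/

theorem eventually_sign_of_hasDerivAt {y : ℝ → ℝ} {v t : ℝ} (hy : HasDerivAt y v t)
    (h0 : y t = 0) (hv : 0 < v) : (∀ᶠ s in 𝓝[<] t, y s < 0) ∧ ∀ᶠ s in 𝓝[>] t, 0 < y s := by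
  have h := hasDerivAt_iff_tendsto_slope.1 hy
  have hpos := h.eventually (lt_mem_nhds hv)
  constructor
  · filter_upwards [nhdsLT_le_nhdsNE t hpos, self_mem_nhdsWithin] with s hs hst
    rw [slope_def_field, h0, sub_zero] at hs
    have : s - t < 0 := sub_neg.2 hst
    by_contra hcon
    exact absurd hs (not_lt.2 (div_nonpos_of_nonneg_of_nonpos (not_lt.1 hcon) this.le))
  · filter_upwards [nhdsGT_le_nhdsNE t hpos, self_mem_nhdsWithin] with s hs hst
    rw [slope_def_field, h0, sub_zero] at hs
    have : 0 < s - t := sub_pos.2 hst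
    by_contra hcon
    exact absurd hs (not_lt.2 (div_nonpos_of_nonpos_of_nonneg (not_lt.1 hcon) this.le))

theorem div_im_eq_cross (u v : ℂ) : (v / u).im = cross u v / Complex.normSq u := by
  rw [Complex.div_im, cross]
  ring

/-- The imaginary part of a transverse path in a tubular chart. -/
theorem exists_chart_im {α : ℝ → ℂ} {t : ℝ} {i : Fin D.n} {s : ℝ} (hs : D.curve i s = α t)
    (hcr : cross (deriv (D.curve i) s) (deriv α t) ≠ 0) :
    ∃ e : OpenPartialHomeomorph ℂ ℂ, ⇑e = D.tube i ∧ (s : ℂ) ∈ e.source ∧ e.symm (α t) = s ∧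
      ContinuousAt α t ∧
      HasDerivAt (fun x => (e.symm (α x)).im)
        (cross (deriv (D.curve i) s) (deriv α t) / Complex.normSq (deriv (D.curve i) s)) t := by
  -- `deriv` is zero where `α` is not differentiable, so transversality already contains
  -- differentiability.
  have hd : DifferentiableAt ℝ α t := by
    by_contra h
    rw [deriv_zero_of_not_differentiableAt h] at hcr
    simp [cross] at hcr
  obtain ⟨e, he, hse, hsymm, hder⟩ := D.exists_tube_chart i s
  refine ⟨e, he, hse, by rw [← hs, hsymm], hd.continuousAt, ?_⟩
  have h1 := hder hd.hasDerivAt hs.symm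
  have h2 := Complex.imCLM.hasFDerivAt.comp_hasDerivAt t h1
  rw [← div_im_eq_cross]
  exact h2

/-- The group element of a letter. -/
def letterElt (l : S × Bool) : FreeGroup S := FreeGroup.mk [l]

theorem letterElt_true (a : S) : letterElt (a, true) = FreeGroup.of a := rfl

theorem letterElt_false (a : S) : letterElt (a, false) = (FreeGroup.of a)⁻¹ := by
  rw [← letterElt_true, letterElt, letterElt, FreeGroup.inv_mk]; rfl

theorem mk_eq_prod (w : SignedWord S) : FreeGroup.mk w = (w.map letterElt).prod := by
  induction w with
  | nil => rfl
  | cons l w ih => rw [List.map_cons, List.prod_cons, ← ih, letterElt, FreeGroup.mul_mk]; rfl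

/-- A section jumps by the intersection letter along a path. -/
theorem IsSectionAt.jumpsAt {f : ℂ → FreeGroup S} {α : ℝ → ℂ} {t : ℝ} {l : S × Bool}
    (h : D.IsSectionAt f (α t)) (hl : D.IsIntersectionLetter α t l) :
    JumpsAt (fun x => f (α x)) t (letterElt l) := by
  -- In the tubular chart the section along `α` depends only on the sign of the imaginary part `y`,
  -- and the sign of `y'` is the direction of passage.
  have main : ∀ i s, D.curve i s = α t → cross (deriv (D.curve i) s) (deriv α t) ≠ 0 →
      ∃ c, ∃ y : ℝ → ℝ, (∀ᶠ x in 𝓝 t, f (α x) = c *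
        (open Classical in if 0 ≤ y x then FreeGroup.of (D.label i) else 1)) ∧ y t = 0 ∧
        HasDerivAt y
          (cross (deriv (D.curve i) s) (deriv α t) / Complex.normSq (deriv (D.curve i) s)) t := by
    intro i s hs hcr
    obtain ⟨e, he, hse, hsymm, hc, hder⟩ := exists_chart_im hs hcr
    obtain ⟨c, hfc⟩ := h.exists_eventually_tube hs
    refine ⟨c, _, ?_, by rw [hsymm, Complex.ofReal_im], hder⟩
    have htgt : α t ∈ e.target := by
      rw [← hs, ← D.tube_ofReal, ← he]; exact e.map_source hse
    have h1 : Tendsto (fun x => e.symm (α x)) (𝓝 t) (𝓝 (s : ℂ)) := by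
      rw [← hsymm]
      exact (e.continuousAt_symm htgt).comp hc
    filter_upwards [h1.eventually hfc, hc.eventually (e.open_target.mem_nhds htgt)] with x hx hxt
    rw [← he, e.right_inv hxt] at hx
    exact hx
  obtain ⟨i, ⟨⟨s, hs, hcr⟩, rfl⟩ | ⟨⟨s, hs, hcr⟩, rfl⟩⟩ := hl
  · obtain ⟨c, y, hf, hy0, hy⟩ := main i s hs hcr.ne'
    obtain ⟨h1, h2⟩ := eventually_sign_of_hasDerivAt hy hy0
      (div_pos hcr (Complex.normSq_pos.2 (D.immersed i s)))
    refine ⟨c, ?_, ?_⟩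
    · filter_upwards [h1, nhdsWithin_le_nhds hf] with x h3 h4
      rw [h4, if_neg (not_le.2 h3), mul_one]
    · filter_upwards [h2, nhdsWithin_le_nhds hf] with x h3 h4
      rw [h4, if_pos (le_of_lt h3), letterElt_true]
  · obtain ⟨c, y, hf, hy0, hy⟩ := main i s hs hcr.ne
    obtain ⟨h1, h2⟩ := eventually_sign_of_hasDerivAt hy.neg (by simp [hy0])
      (neg_pos.2 (div_neg_of_neg_of_pos hcr (Complex.normSq_pos.2 (D.immersed i s))))
    refine ⟨c * FreeGroup.of (D.label i), ?_, ?_⟩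
    · filter_upwards [h1, nhdsWithin_le_nhds hf] with x h3 h4
      have : 0 ≤ y x := by simpa using (le_of_lt h3)
      rw [h4, if_pos this]
    · filter_upwards [h2, nhdsWithin_le_nhds hf] with x h3 h4
      have : y x < 0 := by simpa using h3
      rw [h4, if_neg (not_le.2 this), letterElt_false]
      group

/-- A section along a path is multiplied by the intersection word. -/
theorem section_eq_mul_word {H : ℝ → FreeGroup S} {α : ℝ → ℂ} {a b : ℝ} (hab : a ≤ b)
    (hα : ∀ t ∈ Icc a b, ContinuousAt α t)
    (hH : ∀ t ∈ Icc a b, ∃ f, D.IsSectionAt f (α t) ∧ H =ᶠ[𝓝 t] f ∘ α)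
    (ha : α a ∉ D.support) (hb : α b ∉ D.support) {w : SignedWord S}
    (hw : D.IsIntersectionWord α a b w) : H b = H a * FreeGroup.mk w := by
  obtain ⟨ts, hts, hmem, hletters⟩ := hw
  rw [mk_eq_prod]
  refine eq_mul_prod_of_jumps (ts := ts) ?_ hab hts ?_ ?_
  · rw [List.forall₂_map_right_iff]
    have : ∀ t ∈ ts, t ∈ Icc a b := fun t ht => ((hmem t).1 ht).1
    clear hmem hts
    induction hletters with
    | nil => exact .nil
    | @cons t l ts w hl _ ih =>
      refine .cons ?_ (ih fun t' ht' => this t' (by simp [ht']))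
      obtain ⟨f, hf, hHf⟩ := hH t (this t (by simp))
      refine (hf.jumpsAt hl).congr_mul 1 ?_
      filter_upwards [nhdsWithin_le_nhds hHf] with x hx
      rw [hx, one_mul]; rfl
  · intro t ht
    obtain ⟨h1, h2⟩ := (hmem t).1 ht
    refine ⟨lt_of_le_of_ne h1.1 ?_, lt_of_le_of_ne h1.2 ?_⟩
    · rintro rfl; exact ha h2
    · rintro rfl; exact hb h2
  · intro t ht htn
    obtain ⟨f, hf, hHf⟩ := hH t ht
    obtain ⟨c, hc⟩ := hf.exists_eventually_eq fun h => htn ((hmem t).2 ⟨ht, h⟩)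
    refine ⟨c, ?_⟩
    filter_upwards [hHf, (hα t ht).eventually hc] with x h1 h2
    rw [h1, Function.comp_apply, h2]

end ColoredDiagram

namespace ColoredDiagram

variable {S : Type*} {D : ColoredDiagram S}

/-! ### Intersection words -/

theorem IsIntersectionLetter.eq {α : ℝ → ℂ} {t : ℝ} (ht : α t ∉ D.crossings) {l l' : S × Bool}
    (h : D.IsIntersectionLetter α t l) (h' : D.IsIntersectionLetter α t l') : l = l' := by
  have key : ∀ {i j s r}, D.curve i s = α t → D.curve j r = α t →
      i = j ∧ deriv (D.curve i) s = deriv (D.curve j) r := by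
    intro i j s r hs hr
    obtain ⟨rfl, n, rfl⟩ := D.eq_of_notMem_crossings ht hs hr
    exact ⟨rfl, D.deriv_curve_add_int _ _ _⟩
  obtain ⟨i, ⟨⟨s, hs, hcr⟩, rfl⟩ | ⟨⟨s, hs, hcr⟩, rfl⟩⟩ := h <;>
  obtain ⟨j, ⟨⟨r, hr, hcr'⟩, rfl⟩ | ⟨⟨r, hr, hcr'⟩, rfl⟩⟩ := h' <;>
  obtain ⟨rfl, hd⟩ := key hs hr
  · rfl
  · rw [hd] at hcr; exact absurd hcr hcr'.not_gt
  · rw [hd] at hcr; exact absurd hcr hcr'.not_gt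
  · rfl

/-- The times form the increasing enumeration of a given set, and off the crossings each time has a
single letter. -/
theorem IsIntersectionWord.eq {α : ℝ → ℂ} {a b : ℝ} (hα : ∀ t ∈ Icc a b, α t ∉ D.crossings)
    {w w' : SignedWord S} (h : D.IsIntersectionWord α a b w)
    (h' : D.IsIntersectionWord α a b w') : w = w' := by
  obtain ⟨ts, hts, hmem, hl⟩ := h
  obtain ⟨ts', hts', hmem', hl'⟩ := h'
  have hperm : ts.Perm ts' :=
    (List.perm_ext_iff_of_nodup (hts.imp fun h => h.ne) (hts'.imp fun h => h.ne)).2 fun t =>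
      (hmem t).trans (hmem' t).symm
  obtain rfl := hperm.eq_of_pairwise (fun _ _ _ _ h1 h2 => absurd h1 h2.not_gt) hts hts'
  have hcr : ∀ t ∈ ts, α t ∉ D.crossings := fun t ht => hα t ((hmem t).1 ht).1
  clear hts hts' hmem hmem' hperm
  induction hl generalizing w' with
  | nil => cases hl'; rfl
  | cons hd _ ih =>
    cases hl' with
    | cons hd' htl' =>
      rw [hd.eq (hcr _ (by simp)) hd', ih htl' fun t ht => hcr t (by simp [ht])]

/-- In a tubular chart the diagram lies on the real axis, while the imaginary part of a transverse
path has nonzero derivative. -/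
theorem TransverseAt.eventually_notMem {α : ℝ → ℂ} {t : ℝ} (h : D.TransverseAt α t)
    (hc : ContinuousAt α t) : ∀ᶠ x in 𝓝[≠] t, α x ∉ D.support := by
  by_cases ht : α t ∈ D.support
  · obtain ⟨i, s, hs⟩ := ht
    obtain ⟨e, he, hse, hsymm, -, hder⟩ := exists_chart_im hs (h.2 i s hs)
    have hne := hder.eventually_ne (c := 0)
      (div_ne_zero (h.2 i s hs) (Complex.normSq_pos.2 (D.immersed i s)).ne')
    have htgt : α t ∈ e.target := by
      rw [← hs, ← D.tube_ofReal, ← he]; exact e.map_source hse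
    have h1 : Tendsto (fun x => e.symm (α x)) (𝓝 t) (𝓝 (s : ℂ)) := by
      rw [← hsymm]
      exact (e.continuousAt_symm htgt).comp hc
    have hcr : D.curve i s ∉ D.crossings := by rw [hs]; exact h.1
    filter_upwards [hne, nhdsWithin_le_nhds (h1.eventually (eventually_tube_mem_support hcr)),
      nhdsWithin_le_nhds (hc.eventually (e.open_target.mem_nhds htgt))] with x h2 h3 h4 h5
    rw [← he, e.right_inv h4] at h3
    exact h2 (h3.1 h5)
  · exact nhdsWithin_le_nhds (hc.eventually (D.eventually_notMem_support ht))

theorem exists_isIntersectionWord {α : ℝ → ℂ} {a b : ℝ}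
    (hα : ∀ t ∈ Icc a b, ContinuousAt α t) (h : ∀ t ∈ Icc a b, D.TransverseAt α t) :
    ∃ w, D.IsIntersectionWord α a b w := by
  -- Infinitely many intersection times would accumulate in the compact interval, but each time is
  -- isolated.
  have hfin : {t | t ∈ Icc a b ∧ α t ∈ D.support}.Finite := by
    by_contra hinf
    obtain ⟨t, ht, hacc⟩ := Set.Infinite.exists_accPt_of_subset_isCompact hinf isCompact_Icc
      fun t ht => ht.1
    rw [accPt_iff_frequently_nhdsNE] at hacc
    exact hacc (((h t ht).eventually_notMem (hα t ht)).mono fun x hx hx' => hx hx'.2)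
  have hletter : ∀ t ∈ Icc a b, α t ∈ D.support → ∃ l, D.IsIntersectionLetter α t l := by
    rintro t ht ⟨i, s, hs⟩
    rcases lt_or_gt_of_ne ((h t ht).2 i s hs) with hlt | hgt
    · exact ⟨(D.label i, false), ⟨i, Or.inr ⟨⟨s, hs, hlt⟩, rfl⟩⟩⟩
    · exact ⟨(D.label i, true), ⟨i, Or.inl ⟨⟨s, hs, hgt⟩, rfl⟩⟩⟩
  have hword : ∀ ts : List ℝ, (∀ t ∈ ts, t ∈ Icc a b ∧ α t ∈ D.support) →
      ∃ w, List.Forall₂ (fun t l => D.IsIntersectionLetter α t l) ts w := by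
    intro ts
    induction ts with
    | nil => exact fun _ => ⟨[], .nil⟩
    | cons t ts ih =>
      intro hts
      obtain ⟨w, hw⟩ := ih fun t' ht' => hts t' (by simp [ht'])
      obtain ⟨l, hl⟩ := hletter t (hts t (by simp)).1 (hts t (by simp)).2
      exact ⟨l :: w, .cons hl hw⟩
  have hmem : ∀ t, t ∈ hfin.toFinset.sort (· ≤ ·) ↔ t ∈ Icc a b ∧ α t ∈ D.support := by simp
  obtain ⟨w, hw⟩ := hword _ fun t ht => (hmem t).1 ht
  exact ⟨w, _, (Finset.sortedLT_sort _).pairwise, hmem, hw⟩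

theorem IsIntersectionWord.append {α : ℝ → ℂ} {a b c : ℝ} {w w' : SignedWord S} (hab : a ≤ b)
    (hbc : b ≤ c) (hb : α b ∉ D.support) (h : D.IsIntersectionWord α a b w)
    (h' : D.IsIntersectionWord α b c w') : D.IsIntersectionWord α a c (w ++ w') := by
  obtain ⟨ts, hts, hmem, hl⟩ := h
  obtain ⟨ts', hts', hmem', hl'⟩ := h'
  refine ⟨ts ++ ts', List.pairwise_append.2 ⟨hts, hts', fun t ht t' ht' => ?_⟩, fun t => ?_,
    List.rel_append hl hl'⟩
  · have h1 := (hmem t).1 ht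
    have h2 := (hmem' t').1 ht'
    refine lt_of_lt_of_le (lt_of_le_of_ne h1.1.2 ?_) h2.1.1
    rintro rfl
    exact hb h1.2
  · rw [List.mem_append, hmem, hmem', ← or_and_right, ← mem_union, Icc_union_Icc_eq_Icc hab hbc]

theorem IsIntersectionLetter.congr {α β : ℝ → ℂ} {t t' : ℝ} {l : S × Bool} (h : β t' = α t)
    (hd : deriv β t' = deriv α t) (hl : D.IsIntersectionLetter α t l) :
    D.IsIntersectionLetter β t' l := by
  simpa only [IsIntersectionLetter, PassesRightToLeft, PassesLeftToRight, h, hd] using hl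

theorem IsIntersectionLetter.reverse {α β : ℝ → ℂ} {t t' : ℝ} {l : S × Bool} (h : β t' = α t)
    (hd : deriv β t' = -deriv α t) (hl : D.IsIntersectionLetter α t l) :
    D.IsIntersectionLetter β t' (l.1, !l.2) := by
  have hcr : ∀ u v : ℂ, cross u (-v) = -cross u v := fun u v => by simp [cross]; ring
  obtain ⟨i, ⟨⟨s, hs, hcr'⟩, rfl⟩ | ⟨⟨s, hs, hcr'⟩, rfl⟩⟩ := hl
  · exact ⟨i, Or.inr ⟨⟨s, by rw [h, hs], by rw [hd, hcr]; linarith⟩, rfl⟩⟩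
  · exact ⟨i, Or.inl ⟨⟨s, by rw [h, hs], by rw [hd, hcr]; linarith⟩, rfl⟩⟩

/-- Equality of germs is required only at intersection times, because `Noose.path` may have corners
at the neck, which misses the diagram. -/
theorem IsIntersectionWord.shift {α β : ℝ → ℂ} {a b : ℝ} {w : SignedWord S} (d : ℝ)
    (h : D.IsIntersectionWord α a b w) (hβ : ∀ t ∈ Icc a b, β (t + d) = α t)
    (hβ' : ∀ t ∈ Icc a b, α t ∈ D.support → β =ᶠ[𝓝 (t + d)] fun x => α (x - d)) :
    D.IsIntersectionWord β (a + d) (b + d) w := by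
  obtain ⟨ts, hts, hmem, hl⟩ := h
  have hmem' : ∀ t ∈ ts, t ∈ Icc a b ∧ α t ∈ D.support := fun t ht => (hmem t).1 ht
  refine ⟨ts.map (· + d), ?_, fun t => ?_, ?_⟩
  · exact List.pairwise_map.2 (hts.imp fun h => by linarith)
  · rw [List.mem_map]
    constructor
    · rintro ⟨t, ht, rfl⟩
      have := hmem' t ht
      exact ⟨⟨by linarith [this.1.1], by linarith [this.1.2]⟩, by rw [hβ t this.1]; exact this.2⟩
    · rintro ⟨h1, h2⟩
      have h3 : t - d ∈ Icc a b := ⟨by linarith [h1.1], by linarith [h1.2]⟩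
      refine ⟨t - d, (hmem _).2 ⟨h3, ?_⟩, by ring⟩
      rwa [← hβ _ h3, sub_add_cancel]
  · rw [List.forall₂_map_left_iff]
    clear hmem hts
    induction hl with
    | nil => exact .nil
    | @cons t l ts w hd _ ih =>
      obtain ⟨h1, h2⟩ := hmem' t (by simp)
      refine .cons (hd.congr (hβ t h1) ?_) (ih fun t ht => hmem' t (by simp [ht]))
      rw [(hβ' t h1 h2).deriv_eq, deriv_comp_sub_const, add_sub_cancel_right]

theorem IsIntersectionWord.reverse {α β : ℝ → ℂ} {a b : ℝ} {w : SignedWord S} (d : ℝ)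
    (h : D.IsIntersectionWord α a b w) (hβ : ∀ t ∈ Icc a b, β (d - t) = α t)
    (hβ' : ∀ t ∈ Icc a b, α t ∈ D.support → β =ᶠ[𝓝 (d - t)] fun x => α (d - x)) :
    D.IsIntersectionWord β (d - b) (d - a) (FreeGroup.invRev w) := by
  obtain ⟨ts, hts, hmem, hl⟩ := h
  have hmem' : ∀ t ∈ ts, t ∈ Icc a b ∧ α t ∈ D.support := fun t ht => (hmem t).1 ht
  refine ⟨(ts.map (d - ·)).reverse, ?_, fun t => ?_, ?_⟩
  · rw [List.pairwise_reverse]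
    exact List.pairwise_map.2 (hts.imp fun h => by linarith)
  · rw [List.mem_reverse, List.mem_map]
    constructor
    · rintro ⟨t, ht, rfl⟩
      have := hmem' t ht
      exact ⟨⟨by linarith [this.1.2], by linarith [this.1.1]⟩, by rw [hβ t this.1]; exact this.2⟩
    · rintro ⟨h1, h2⟩
      have h3 : d - t ∈ Icc a b := ⟨by linarith [h1.2], by linarith [h1.1]⟩
      refine ⟨d - t, (hmem _).2 ⟨h3, ?_⟩, by ring⟩
      rwa [← hβ _ h3, sub_sub_cancel]
  · rw [FreeGroup.invRev, List.forall₂_reverse_iff, List.forall₂_map_left_iff,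
      List.forall₂_map_right_iff]
    clear hmem hts
    induction hl with
    | nil => exact .nil
    | @cons t l ts w hd _ ih =>
      obtain ⟨h1, h2⟩ := hmem' t (by simp)
      refine .cons (hd.reverse (hβ t h1) ?_) (ih fun t ht => hmem' t (by simp [ht]))
      rw [(hβ' t h1 h2).deriv_eq, deriv_comp_const_sub, sub_sub_cancel]

end ColoredDiagram

/-! ### Nooses and their intersection words -/

theorem isCompact_ropeModel : IsCompact ropeModel :=
  isCompact_Icc.image Complex.continuous_ofReal

theorem isCompact_nooseModel : IsCompact nooseModel :=
  (isCompact_closedBall 0 1).union isCompact_ropeModel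

theorem ofReal_mem_nooseModel {x : ℝ} (hx : x ∈ Icc (1 : ℝ) 2) : (x : ℂ) ∈ nooseModel :=
  Or.inr ⟨x, hx, rfl⟩

theorem exp_mem_nooseModel (x : ℝ) : Complex.exp (x * Complex.I) ∈ nooseModel :=
  Or.inl (by simp [Complex.norm_exp_ofReal_mul_I])

namespace Noose

variable (N : Noose)

theorem contDiffAt {z : ℂ} (hz : z ∈ nooseModel) : ContDiffAt ℝ ∞ N.toFun z := by
  obtain ⟨U, hU, hsub, h⟩ := N.smooth
  exact h.contDiffAt (hU.mem_nhds (hsub hz))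

theorem eventually_continuousAt {z : ℂ} (hz : z ∈ nooseModel) :
    ∀ᶠ y in 𝓝 z, ContinuousAt N.toFun y := by
  obtain ⟨U, hU, hsub, h⟩ := N.smooth
  filter_upwards [hU.mem_nhds (hsub hz)] with y hy
  exact (h.contDiffAt (hU.mem_nhds hy)).continuousAt

theorem continuousAt {z : ℂ} (hz : z ∈ nooseModel) : ContinuousAt N.toFun z :=
  (N.contDiffAt hz).continuousAt

theorem continuousOn : ContinuousOn N.toFun nooseModel :=
  fun _ hz => (N.continuousAt hz).continuousWithinAt

theorem isCompact_image : IsCompact N.image := isCompact_nooseModel.image_of_continuousOn N.continuousOn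

theorem exists_chart {z : ℂ} (hz : z ∈ nooseModel) :
    ∃ e : OpenPartialHomeomorph ℂ ℂ, ⇑e = N.toFun ∧ z ∈ e.source ∧
      ∃ f' : ℂ →L[ℝ] ℂ, HasFDerivAt e.symm f' (N.toFun z) ∧
        ∀ v, fderiv ℝ N.toFun z (f' v) = v := by
  have h : HasStrictFDerivAt N.toFun _ z := (N.contDiffAt hz).hasStrictFDerivAt (by simp)
  rw [← ContinuousLinearMap.coe_toContinuousLinearEquivOfDetNeZero _ (N.orientation z hz).ne'] at h
  refine ⟨h.toOpenPartialHomeomorph N.toFun, rfl, h.mem_toOpenPartialHomeomorph_source, _,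
    h.to_localInverse.hasFDerivAt, fun v => ?_⟩
  exact ContinuousLinearEquiv.apply_symm_apply
    ((fderiv ℝ N.toFun z).toContinuousLinearEquivOfDetNeZero (N.orientation z hz).ne') v

theorem continuousAt_ropePath {x : ℝ} (hx : x ∈ Icc (1 : ℝ) 2) : ContinuousAt N.ropePath x :=
  ContinuousAt.comp (f := fun x : ℝ => (x : ℂ)) (N.continuousAt (ofReal_mem_nooseModel hx))
    Complex.continuous_ofReal.continuousAt

theorem continuousAt_loopPath (s : ℝ) : ContinuousAt N.loopPath s :=
  ContinuousAt.comp (f := fun s : ℝ => Complex.exp ((2 * Real.pi * s : ℝ) * Complex.I))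
    (N.continuousAt (exp_mem_nooseModel _)) (by fun_prop)

theorem loopPath_zero : N.loopPath 0 = N.neck := by simp [loopPath, neck]

theorem loopPath_one : N.loopPath 1 = N.neck := by
  simp [loopPath, neck, Complex.exp_two_pi_mul_I]

theorem ropePath_one : N.ropePath 1 = N.neck := by simp [ropePath, neck]

theorem ropePath_two : N.ropePath 2 = N.root := by simp [ropePath, root]

variable {N} {S : Type*} {D : ColoredDiagram S}

theorem IsFor.path_notMem_crossings (h : N.IsFor D) : ∀ t ∈ Icc (0 : ℝ) 3, N.path t ∉ D.crossings := by
  intro t ht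
  unfold path
  split_ifs with h1 h2
  · exact (h.rope_transverse _ ⟨by linarith, by linarith [ht.1]⟩).1
  · exact (h.loop_transverse _ ⟨by linarith, by linarith⟩).1
  · exact (h.rope_transverse _ ⟨by linarith, by linarith [ht.2]⟩).1

theorem IsFor.exists_rope_word (h : N.IsFor D) : ∃ u, D.IsIntersectionWord N.ropePath 1 2 u :=
  ColoredDiagram.exists_isIntersectionWord (fun _ ht => N.continuousAt_ropePath ht)
    h.rope_transverse

/-- The three stretches of the path contribute `u⁻¹`, `v` and `u`; they are joined at the neck,
where no letter occurs. -/
theorem IsFor.isIntersectionWord (h : N.IsFor D) {u v : SignedWord S}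
    (hu : D.IsIntersectionWord N.ropePath 1 2 u) (hv : D.IsIntersectionWord N.loopPath 0 1 v) :
    N.IsIntersectionWord D (conjWord v u) := by
  have hroot : N.ropePath 2 ∉ D.support := by rw [ropePath_two]; exact h.root_notMem
  have hneck : N.ropePath 1 ∉ D.support := by rw [ropePath_one]; exact h.neck_notMem
  have hl0 : N.loopPath 0 ∉ D.support := by rw [loopPath_zero]; exact h.neck_notMem
  have hl1 : N.loopPath 1 ∉ D.support := by rw [loopPath_one]; exact h.neck_notMem
  have p1 : ∀ t ≤ 1, N.path t = N.ropePath (2 - t) := fun t ht => if_pos ht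
  have p2 : ∀ t, 1 < t → t ≤ 2 → N.path t = N.loopPath (t - 1) := fun t ht ht' => by
    rw [path, if_neg (not_le.2 ht), if_pos ht']
  have p3 : ∀ t, 2 < t → N.path t = N.ropePath (t - 1) := fun t ht => by
    rw [path, if_neg (by linarith), if_neg (by linarith)]
  have path_one : N.path 1 = N.neck := by rw [p1 1 le_rfl, ← ropePath_one]; norm_num
  have path_two : N.path 2 = N.neck := by
    rw [p2 2 (by norm_num) le_rfl, ← loopPath_one]; norm_num
  have h1 : D.IsIntersectionWord N.path (2 - 2) (2 - 1) (FreeGroup.invRev u) := by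
    refine hu.reverse 2 (fun t ht => ?_) (fun t ht hts => ?_)
    · rw [p1 _ (by linarith [ht.1]), sub_sub_cancel]
    · have : 1 < t := lt_of_le_of_ne ht.1 (by rintro rfl; exact hneck hts)
      filter_upwards [gt_mem_nhds (show 2 - t < 1 by linarith)] with x hx
      exact p1 x (le_of_lt hx)
  have h2 : D.IsIntersectionWord N.path (0 + 1) (1 + 1) v := by
    refine hv.shift 1 (fun t ht => ?_) (fun t ht hts => ?_)
    · rcases eq_or_lt_of_le ht.1 with rfl | h0
      · rw [zero_add, path_one, loopPath_zero]
      · rw [p2 _ (by linarith) (by linarith [ht.2]), add_sub_cancel_right]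
    · have h3 : 0 < t := lt_of_le_of_ne ht.1 (by rintro rfl; exact hl0 hts)
      have h4 : t < 1 := lt_of_le_of_ne ht.2 (by rintro rfl; exact hl1 hts)
      filter_upwards [gt_mem_nhds (show t + 1 < 2 by linarith),
        lt_mem_nhds (show 1 < t + 1 by linarith)] with x hx hx'
      exact p2 x hx' (le_of_lt hx)
  have h3 : D.IsIntersectionWord N.path (1 + 1) (2 + 1) u := by
    refine hu.shift 1 (fun t ht => ?_) (fun t ht hts => ?_)
    · rcases eq_or_lt_of_le ht.1 with rfl | h0
      · rw [one_add_one_eq_two, path_two, ropePath_one]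
      · rw [p3 _ (by linarith), add_sub_cancel_right]
    · have h3 : 1 < t := lt_of_le_of_ne ht.1 (by rintro rfl; exact hneck hts)
      filter_upwards [lt_mem_nhds (show 2 < t + 1 by linarith)] with x hx
      exact p3 x hx
  norm_num at h1 h2 h3
  have h12 := h1.append (by norm_num) (by norm_num) (by rw [path_one]; exact h.neck_notMem) h2
  exact h12.append (by norm_num) (by norm_num) (by rw [path_two]; exact h.neck_notMem) h3

/-- The four passages of (P2) read `a⁻¹ b⁻¹ a b`, which is the word `(a, b)` in the present
convention. -/
theorem IsProper.exists_loop_word (hp : N.IsProper D) :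
    ∃ a b, D.IsIntersectionWord N.loopPath 0 1 (commWord (letterWord a) (letterWord b)) := by
  obtain ⟨i, j, s₁, s₂, s₃, s₄, h0, h12, h23, h34, h41, hmem, h1, h2, h3, h4⟩ := hp.passes
  refine ⟨D.label i, D.label j, [s₁, s₂, s₃, s₄], ?_, ?_, ?_⟩
  · simp only [List.pairwise_cons, List.mem_cons, List.not_mem_nil, or_false, forall_eq_or_imp,
      forall_eq, IsEmpty.forall_iff, implies_true, List.Pairwise.nil, and_true]
    refine ⟨⟨?_, ?_, ?_⟩, ⟨?_, ?_⟩, ?_⟩ <;> linarith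
  · intro t
    simp only [List.mem_cons, List.not_mem_nil, or_false]
    constructor
    · intro ht
      have : t ∈ Icc (0 : ℝ) 1 := by
        rcases ht with rfl | rfl | rfl | rfl <;> constructor <;> linarith
      exact ⟨this, (hmem t this).2 ht⟩
    · exact fun ht => (hmem t ht.1).1 ht.2
  · exact .cons ⟨i, Or.inr ⟨h1, rfl⟩⟩ (.cons ⟨j, Or.inr ⟨h2, rfl⟩⟩
      (.cons ⟨i, Or.inl ⟨h3, rfl⟩⟩ (.cons ⟨j, Or.inl ⟨h4, rfl⟩⟩ .nil)))

end Noose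

/-! ((continuousAt_neg (x := z)).clog hz)# The local system around a noose -/

/-- The branch of the logarithm with imaginary part in `(0, 2π]`. -/
noncomputable def cutLog (z : ℂ) : ℂ := Complex.log (-z) + Real.pi * Complex.I

theorem exp_cutLog {z : ℂ} (hz : z ≠ 0) : Complex.exp (cutLog z) = z := by
  rw [cutLog, Complex.exp_add, Complex.exp_log (neg_ne_zero.2 hz), Complex.exp_pi_mul_I]
  ring

theorem cutLog_of_im_pos {z : ℂ} (hz : 0 < z.im) : cutLog z = Complex.log z := by
  rw [cutLog, Complex.log, Complex.log, norm_neg, Complex.arg_neg_eq_arg_sub_pi_of_im_pos hz]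
  push_cast; ring

theorem cutLog_of_im_neg {z : ℂ} (hz : z.im < 0) :
    cutLog z = Complex.log z + 2 * Real.pi * Complex.I := by
  rw [cutLog, Complex.log, Complex.log, norm_neg, Complex.arg_neg_eq_arg_add_pi_of_im_neg hz]
  push_cast; ring

theorem continuousAt_cutLog {z : ℂ} (hz : -z ∈ Complex.slitPlane) : ContinuousAt cutLog z :=
  ((continuousAt_neg (x := z)).clog hz).add continuousAt_const

theorem neg_mem_slitPlane_of_norm_eq_one {z : ℂ} (hz : ‖z‖ = 1) (hz1 : z ≠ 1) :
    -z ∈ Complex.slitPlane := by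
  rw [Complex.mem_slitPlane_iff]
  by_contra! hcon
  simp only [Complex.neg_re, Complex.neg_im, neg_eq_zero] at hcon
  obtain ⟨h1, h2⟩ := hcon
  refine hz1 ?_
  have h3 : (z.re : ℂ) = z := Complex.ext rfl h2.symm
  rw [← h3, Complex.norm_real, Real.norm_eq_abs, abs_of_nonneg (by linarith)] at hz
  rw [← h3, hz, Complex.ofReal_one]

theorem cutLog_of_norm_eq_one {z : ℂ} (hz : ‖z‖ = 1) :
    cutLog z ∈ ({0} : Set ℝ) ×ℂ Icc 0 (2 * Real.pi) := by
  have h1 : (cutLog z).re = 0 := by simp [cutLog, Complex.log_re, hz]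
  have h2 : (cutLog z).im = Complex.arg (-z) + Real.pi := by simp [cutLog, Complex.log_im]
  refine ⟨h1, ?_⟩
  rw [mem_preimage, h2]
  constructor <;> linarith [Complex.neg_pi_lt_arg (-z), Complex.arg_le_pi (-z)]

/-- Transfers the side on which a path leaves the rope between a noose and its model. -/
theorem cross_map (A : ℂ →L[ℝ] ℂ) (u v : ℂ) : cross (A u) (A v) = A.det * cross u v := by
  have hA : ∀ w : ℂ, A w = w.re • A 1 + w.im • A Complex.I := by
    intro w
    rw [← map_smul, ← map_smul, ← map_add]
    congr 1
    simp [Complex.re_add_im]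
  have hdet : A.det = cross (A 1) (A Complex.I) := by
    rw [ContinuousLinearMap.det, ← LinearMap.det_toMatrix Complex.basisOneI, Matrix.det_fin_two]
    simp [LinearMap.toMatrix_apply, cross]
    ring
  rw [hdet, hA u, hA v]
  simp only [cross, Complex.add_re, Complex.add_im, Complex.real_smul, Complex.mul_re,
    Complex.mul_im, Complex.ofReal_re, Complex.ofReal_im]
  ring

namespace Noose

variable {N : Noose} {S : Type*} {D : ColoredDiagram S}

/-- The model rope is a rectangle of height zero. Since sections are germs, `k` is a section in a
neighbourhood of it. -/
theorem IsFor.exists_rope_section (h : N.IsFor D) :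
    ∃ k, ∀ x ∈ Icc (1 : ℝ) 2, (D.localSystem.comap N.toFun).Sec k x := by
  obtain ⟨k, hk⟩ := (D.localSystem.comap N.toFun).exists_section_rectangle
    (show (1 : ℝ) ≤ 2 by norm_num) (le_refl (0 : ℝ)) fun z hz => by
      obtain ⟨h1, h2⟩ := hz
      have h3 : (z.re : ℂ) = z := Complex.ext rfl (le_antisymm h2.1 h2.2)
      rw [← h3]
      obtain ⟨f, hf⟩ := ColoredDiagram.exists_isSectionAt (h.rope_transverse z.re h1).1
      exact ⟨_, N.eventually_continuousAt (ofReal_mem_nooseModel h1), f, hf, EventuallyEq.rfl⟩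
  exact ⟨k, fun x hx => hk x ⟨by simpa using hx, by simp⟩⟩

theorem eventually_continuousAt_exp (N : Noose) {z : ℂ} (hz : Complex.exp z ∈ nooseModel) :
    ∀ᶠ y in 𝓝 z, ContinuousAt (fun ζ => N.toFun (Complex.exp ζ)) y := by
  filter_upwards [Complex.continuous_exp.continuousAt.eventually (N.eventually_continuousAt hz)]
    with y hy
  exact ContinuousAt.comp (f := Complex.exp) hy Complex.continuous_exp.continuousAt

/-- Passing to the logarithm unrolls the loop to a segment, so the section may take unrelated values
at the two ends. -/
theorem IsFor.exists_loop_section (h : N.IsFor D) :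
    ∃ k, ∀ z ∈ ({0} : Set ℝ) ×ℂ Icc 0 (2 * Real.pi),
      (D.localSystem.comap fun ζ => N.toFun (Complex.exp ζ)).Sec k z := by
  have h0 : ({0} : Set ℝ) = Icc 0 0 := by simp
  rw [h0]
  refine LocalSystem.exists_section_rectangle _ le_rfl (by positivity) fun z hz => ?_
  obtain ⟨h1, h2⟩ := hz
  have h3 : ((2 * Real.pi * (z.im / (2 * Real.pi)) : ℝ) : ℂ) * Complex.I = z := by
    rw [mul_div_cancel₀ _ (by positivity)]
    refine Complex.ext ?_ ?_
    · simpa using (le_antisymm h1.2 h1.1).symm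
    · simp
  have hcr := (h.loop_transverse (z.im / (2 * Real.pi))
    ⟨div_nonneg h2.1 (by positivity), div_le_one_of_le₀ h2.2 (by positivity)⟩).1
  rw [loopPath, h3] at hcr
  obtain ⟨f, hf⟩ := ColoredDiagram.exists_isSectionAt hcr
  refine ⟨_, N.eventually_continuousAt_exp ?_, f, hf, EventuallyEq.rfl⟩
  rw [← h3]
  exact exp_mem_nooseModel _

/-- A section on a neighbourhood of the noose, cut along the rope and the disk. It jumps by the word
of the noose when the rope is passed from the left to the right of the direction towards the root. -/
theorem IsFor.exists_model_cut (h : N.IsFor D) {u v : SignedWord S}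
    (hu : D.IsIntersectionWord N.ropePath 1 2 u) (hv : D.IsIntersectionWord N.loopPath 0 1 v) :
    ∃ k : ℂ → FreeGroup S,
      (∀ x ∈ nooseModel, x ≠ 2 → ∀ᶠ z in 𝓝 x, z ∉ nooseModel →
        (D.localSystem.comap N.toFun).Sec k z) ∧
      ∀ x ∈ Ioo (1 : ℝ) 2, (∀ x' ∈ Icc x 2, N.ropePath x' ∉ D.support) →
        ∃ c, ∀ᶠ z in 𝓝 (x : ℂ), (0 < z.im → k z = c) ∧
          (z.im < 0 → k z = c * FreeGroup.mk (conjWord v u)) := by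
  obtain ⟨kr, hkr⟩ := h.exists_rope_section
  obtain ⟨kl, hkl⟩ := h.exists_loop_section
  have hkr1 : ∀ ζ : ℂ, Complex.exp ζ = 1 →
      (D.localSystem.comap fun ζ => N.toFun (Complex.exp ζ)).Sec (fun ζ => kr (Complex.exp ζ)) ζ := by
    intro ζ hζ
    obtain ⟨-, f, hf, hkf⟩ := hkr 1 ⟨le_rfl, one_le_two⟩
    rw [Complex.ofReal_one] at hf hkf
    refine ⟨N.eventually_continuousAt_exp (by rw [hζ]; exact Or.inl (by simp)), f,
      by simpa only [hζ] using hf, ?_⟩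
    rw [← hζ] at hkf
    exact Complex.continuous_exp.continuousAt.eventually hkf
  have hpi := Real.pi_pos
  -- `c₁` and `c₂` compare the start and the end of the loop section with the rope section at the
  -- neck; together they record the monodromy of the loop.
  obtain ⟨c₁, hc₁⟩ := LocalSystem.unique _ (hkr1 0 Complex.exp_zero)
    (hkl 0 ⟨rfl, by simp; positivity⟩)
  obtain ⟨c₂, hc₂⟩ := LocalSystem.unique _
    (hkr1 (2 * Real.pi * Complex.I) Complex.exp_two_pi_mul_I)
    (hkl (2 * Real.pi * Complex.I) ⟨by simp, by simp; positivity⟩)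
  obtain ⟨ε₁, hε₁, hb₁⟩ := Metric.eventually_nhds_iff_ball.1 hc₁
  obtain ⟨ε₂, hε₂, hb₂⟩ := Metric.eventually_nhds_iff_ball.1 hc₂
  have hlog : ∀ᶠ z in 𝓝 (1 : ℂ), ‖Complex.log z‖ < ε₁ ∧ ‖Complex.log z‖ < ε₂ := by
    have hcont : ContinuousAt (fun z => ‖Complex.log z‖) 1 :=
      (continuousAt_clog (by simp)).norm
    have h1 := hcont.eventually (gt_mem_nhds (show ‖Complex.log 1‖ < ε₁ by simpa))
    have h2 := hcont.eventually (gt_mem_nhds (show ‖Complex.log 1‖ < ε₂ by simpa))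
    exact h1.and h2
  -- On the unit circle `‖x - 1‖² = 2 - 2 Re x`, so `2 * η < ρ ^ 2` puts the points with `Re x ≥ 1 -
  -- η` into the ball of radius `ρ` around the neck.
  obtain ⟨ρ, hρ, hlogρ⟩ := Metric.eventually_nhds_iff_ball.1 hlog
  obtain ⟨η, hη0, hη1, hηρ⟩ : ∃ η : ℝ, 0 < η ∧ η ≤ 1 / 2 ∧ 2 * η < ρ ^ 2 :=
    ⟨min (1 / 2) (ρ ^ 2 / 4), by positivity, min_le_left _ _, by
      have := min_le_right (1 / 2) (ρ ^ 2 / 4)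
      nlinarith [pow_pos hρ 2]⟩
  classical
  -- Near the rope this is the rope section, scaled by `c₁` above and by `c₂` below; elsewhere it is
  -- the loop section. The two definitions agree near the circle, except at the neck.
  set k : ℂ → FreeGroup S := fun z =>
    if 1 - η < z.re then (if 0 < z.im then c₁ * kr z else c₂ * kr z) else kl (cutLog z) with hk
  have hkpos : ∀ z : ℂ, 1 - η < z.re → 0 < z.im → k z = c₁ * kr z := fun z h1 h2 => by
    simp only [hk, if_pos h1, if_pos h2]
  have hkneg : ∀ z : ℂ, 1 - η < z.re → z.im < 0 → k z = c₂ * kr z := fun z h1 h2 => by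
    simp only [hk, if_pos h1, if_neg h2.not_gt]
  have hkre : ∀ z : ℂ, ¬ 1 - η < z.re → k z = kl (cutLog z) := fun z h1 => by
    simp only [hk, if_neg h1]
  -- on the circle
  have hcircle : ∀ x : ℂ, ‖x‖ = 1 → x ≠ 1 → ∀ᶠ z in 𝓝 x, k z = kl (cutLog z) := by
    intro x hx hx1
    have hcont := continuousAt_cutLog (neg_mem_slitPlane_of_norm_eq_one hx hx1)
    have hx0 : ∀ᶠ z in 𝓝 x, z ≠ 0 := isOpen_ne.mem_nhds (by rintro rfl; simp at hx)
    rcases lt_or_ge x.re (1 - η) with hre | hre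
    · filter_upwards [Complex.continuous_re.continuousAt.eventually (gt_mem_nhds hre)] with z hz
      exact hkre z (not_lt.2 (le_of_lt hz))
    have hsq : x.re ^ 2 + x.im ^ 2 = 1 := by
      have := Complex.sq_norm x
      rw [hx, Complex.normSq_apply] at this
      linarith
    have hdist : x ∈ Metric.ball (1 : ℂ) ρ := by
      rw [mem_ball_iff_norm]
      refine lt_of_pow_lt_pow_left₀ 2 hρ.le ?_
      rw [Complex.sq_norm, Complex.normSq_apply]
      simp only [Complex.sub_re, Complex.sub_im, Complex.one_re, Complex.one_im]
      nlinarith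
    obtain ⟨hl₁, hl₂⟩ := hlogρ x hdist
    have him : x.im ≠ 0 := by
      intro h0
      have h1 : x.re = 1 := by
        rw [h0] at hsq
        nlinarith
      exact hx1 (Complex.ext h1 h0)
    rcases lt_or_gt_of_ne him with hneg | hpos
    · have hball : ∀ᶠ z in 𝓝 x, cutLog z ∈ Metric.ball (2 * Real.pi * Complex.I : ℂ) ε₂ := by
        refine hcont.eventually (Metric.isOpen_ball.mem_nhds ?_)
        rw [mem_ball_iff_norm, cutLog_of_im_neg hneg, add_sub_cancel_right]
        exact hl₂
      filter_upwards [hball, hx0,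
        Complex.continuous_im.continuousAt.eventually (gt_mem_nhds hneg)] with z hz hz0 hzim
      by_cases h1 : 1 - η < z.re
      · rw [hkneg z h1 hzim, hb₂ _ hz, exp_cutLog hz0]
      · exact hkre z h1
    · have hball : ∀ᶠ z in 𝓝 x, cutLog z ∈ Metric.ball (0 : ℂ) ε₁ := by
        refine hcont.eventually (Metric.isOpen_ball.mem_nhds ?_)
        rw [mem_ball_iff_norm, cutLog_of_im_pos hpos, sub_zero]
        exact hl₁
      filter_upwards [hball, hx0,
        Complex.continuous_im.continuousAt.eventually (lt_mem_nhds hpos)] with z hz hz0 hzim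
      by_cases h1 : 1 - η < z.re
      · rw [hkpos z h1 hzim, hb₁ _ hz, exp_cutLog hz0]
      · exact hkre z h1
  have hcircle' : ∀ x : ℂ, ‖x‖ = 1 → x ≠ 1 → (D.localSystem.comap N.toFun).Sec k x := by
    intro x hx hx1
    have hx0 : x ≠ 0 := by rintro rfl; simp at hx
    obtain ⟨-, f, hf, hklf⟩ := hkl _ (cutLog_of_norm_eq_one hx)
    simp only [exp_cutLog hx0] at hf
    refine ⟨N.eventually_continuousAt (Or.inl (by simp [hx])), f, hf, ?_⟩
    filter_upwards [hcircle x hx hx1, isOpen_ne.mem_nhds hx0,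
      (continuousAt_cutLog (neg_mem_slitPlane_of_norm_eq_one hx hx1)).eventually hklf] with z h1 h2 h3
    rw [h1, h3, Function.comp_apply, Function.comp_apply, exp_cutLog h2]
  -- on the rope
  have hrope : ∀ x ∈ Icc (1 : ℝ) 2, ∀ᶠ z in 𝓝 (x : ℂ), z.im ≠ 0 →
      (D.localSystem.comap N.toFun).Sec k z := by
    intro x hx
    filter_upwards [LocalSystem.eventually _ (hkr x hx),
      Complex.continuous_re.continuousAt.eventually
        (lt_mem_nhds (show 1 - η < (x : ℂ).re by rw [Complex.ofReal_re]; linarith [hx.1]))]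
      with z h1 h2 h3
    rcases lt_or_gt_of_ne h3 with hneg | hpos
    · refine LocalSystem.congr _ ?_ (LocalSystem.smul _ c₂ h1)
      filter_upwards [Complex.continuous_im.continuousAt.eventually (gt_mem_nhds hneg),
        Complex.continuous_re.continuousAt.eventually (lt_mem_nhds h2)] with y h4 h5
      exact (hkneg y h5 h4).symm
    · refine LocalSystem.congr _ ?_ (LocalSystem.smul _ c₁ h1)
      filter_upwards [Complex.continuous_im.continuousAt.eventually (lt_mem_nhds hpos),
        Complex.continuous_re.continuousAt.eventually (lt_mem_nhds h2)] with y h4 h5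
      exact (hkpos y h5 h4).symm
  -- Real points near `[1, 2)` belong to the disk or the rope. This fails at the root `2`, which is
  -- therefore excluded.
  have hreal : ∀ x ∈ Ico (1 : ℝ) 2, ∀ᶠ z in 𝓝 (x : ℂ), z ∉ nooseModel → z.im ≠ 0 := by
    intro x hx
    filter_upwards [Complex.continuous_re.continuousAt.eventually
        (lt_mem_nhds (show 0 < (x : ℂ).re by rw [Complex.ofReal_re]; linarith [hx.1])),
      Complex.continuous_re.continuousAt.eventually
        (gt_mem_nhds (show (x : ℂ).re < 2 by rw [Complex.ofReal_re]; exact hx.2))] with z h1 h2 h3 h4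
    have h5 : (z.re : ℂ) = z := Complex.ext rfl h4.symm
    refine h3 ?_
    rw [← h5]
    rcases le_total z.re 1 with h6 | h6
    · refine Or.inl ?_
      rw [mem_closedBall_zero_iff, Complex.norm_real, Real.norm_eq_abs, abs_of_pos h1]
      exact h6
    · exact ofReal_mem_nooseModel ⟨h6, le_of_lt h2⟩
  refine ⟨k, ?_, ?_⟩
  · have key : ∀ x ∈ Ico (1 : ℝ) 2, ∀ᶠ z in 𝓝 (x : ℂ), z ∉ nooseModel →
        (D.localSystem.comap N.toFun).Sec k z := fun x hx => by
      filter_upwards [hrope x ⟨hx.1, hx.2.le⟩, hreal x hx] with z h1 h2 h3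
      exact h1 (h2 h3)
    rintro x (hx | ⟨x, hx, rfl⟩) hx2
    · rw [mem_closedBall_zero_iff] at hx
      rcases lt_or_eq_of_le hx with hlt | heq
      · filter_upwards [continuous_norm.continuousAt.eventually (gt_mem_nhds hlt)] with z hz hz'
        exact absurd (Or.inl (by simpa using le_of_lt hz)) hz'
      · rcases eq_or_ne x 1 with rfl | hne
        · exact_mod_cast key 1 ⟨le_rfl, one_lt_two⟩
        · filter_upwards [LocalSystem.eventually _ (hcircle' x heq hne)] with z hz _
          exact hz
    · exact key x ⟨hx.1, lt_of_le_of_ne hx.2 (by rintro rfl; exact hx2 (by simp))⟩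
  · intro x hx hxs
    have hroot : N.ropePath 2 ∉ D.support := by rw [ropePath_two]; exact h.root_notMem
    have hneck : N.ropePath 1 ∉ D.support := by rw [ropePath_one]; exact h.neck_notMem
    have hl0 : N.loopPath 0 ∉ D.support := by rw [loopPath_zero]; exact h.neck_notMem
    have hl1 : N.loopPath 1 ∉ D.support := by rw [loopPath_one]; exact h.neck_notMem
    have hH : ∀ t ∈ Icc (1 : ℝ) 2, ∃ f, D.IsSectionAt f (N.ropePath t) ∧
        (fun t : ℝ => kr t) =ᶠ[𝓝 t] f ∘ N.ropePath := by
      intro t ht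
      obtain ⟨-, f, hf, hkf⟩ := hkr t ht
      exact ⟨f, hf, Complex.continuous_ofReal.continuousAt.eventually hkf⟩
    have e1 : kr (2 : ℝ) = kr (1 : ℝ) * FreeGroup.mk u :=
      ColoredDiagram.section_eq_mul_word (H := fun t : ℝ => kr t) one_le_two
        (fun t ht => N.continuousAt_ropePath ht) hH hneck hroot hu
    have e2 : kr (2 : ℝ) = kr (x : ℝ) * FreeGroup.mk [] := by
      refine ColoredDiagram.section_eq_mul_word (H := fun t : ℝ => kr t) (α := N.ropePath) hx.2.le
        (fun t ht => N.continuousAt_ropePath ⟨hx.1.le.trans ht.1, ht.2⟩)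
        (fun t ht => hH t ⟨hx.1.le.trans ht.1, ht.2⟩) (hxs x ⟨le_rfl, hx.2.le⟩) hroot
        ⟨[], .nil, fun t => ?_, .nil⟩
      simp only [List.not_mem_nil, false_iff, not_and]
      exact fun ht => hxs t ht
    have hpath : Tendsto (fun s : ℝ => ((2 * Real.pi * s : ℝ) : ℂ) * Complex.I) (𝓝 0) (𝓝 0) := by
      have : Continuous fun s : ℝ => ((2 * Real.pi * s : ℝ) : ℂ) * Complex.I := by fun_prop
      simpa using this.tendsto 0
    have e3 := ColoredDiagram.section_eq_mul_word
      (H := fun s : ℝ => kl (((2 * Real.pi * s : ℝ) : ℂ) * Complex.I)) zero_le_one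
      (fun t _ => N.continuousAt_loopPath t) (fun t ht => by
        have hmem : ((2 * Real.pi * t : ℝ) : ℂ) * Complex.I ∈
            ({0} : Set ℝ) ×ℂ Icc 0 (2 * Real.pi) := by
          refine ⟨by simp, ?_⟩
          simp only [mem_preimage, Complex.im_ofReal_mul, Complex.I_im, mul_one]
          exact ⟨by have := ht.1; positivity, by nlinarith [ht.2]⟩
        obtain ⟨-, f, hf, hkf⟩ := hkl _ hmem
        have hcont : Continuous fun s : ℝ => ((2 * Real.pi * s : ℝ) : ℂ) * Complex.I := by
          fun_prop
        exact ⟨f, hf, hcont.continuousAt.eventually hkf⟩) hl0 hl1 hv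
    have e4 := hc₁.self_of_nhds
    have e5 := hc₂.self_of_nhds
    simp only [mul_one, mul_zero, Complex.ofReal_zero, zero_mul, Complex.ofReal_mul,
      Complex.ofReal_ofNat, Complex.exp_zero, Complex.exp_two_pi_mul_I] at e3 e4 e5
    rw [e4, e5] at e3
    obtain ⟨-, f, hf, hkf⟩ := hkr x ⟨hx.1.le, hx.2.le⟩
    obtain ⟨c, hc⟩ := hf.exists_eventually_eq (hxs x ⟨le_rfl, hx.2.le⟩)
    have hconst : ∀ᶠ z in 𝓝 (x : ℂ), kr z = c := by
      filter_upwards [hkf, (N.continuousAt (ofReal_mem_nooseModel ⟨hx.1.le, hx.2.le⟩)).eventually hc]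
        with z h1 h2
      rw [h1, Function.comp_apply, h2]
    have hcx := hconst.self_of_nhds
    have hmk : FreeGroup.mk (conjWord v u) =
        (FreeGroup.mk u)⁻¹ * FreeGroup.mk v * FreeGroup.mk u := by
      rw [conjWord, ← FreeGroup.mul_mk, ← FreeGroup.mul_mk, FreeGroup.inv_mk]
    have hcu : c = kr 1 * FreeGroup.mk u := by
      rw [← hcx]
      simpa [← FreeGroup.one_eq_mk] using e2.symm.trans e1
    refine ⟨c₁ * c, ?_⟩
    filter_upwards [hconst, Complex.continuous_re.continuousAt.eventually
        (lt_mem_nhds (show 1 - η < (x : ℂ).re by rw [Complex.ofReal_re]; linarith [hx.1]))]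
      with z h1 h2
    refine ⟨fun h3 => by rw [hkpos z h2 h3, h1], fun h3 => ?_⟩
    -- With `κ = kr 1`: the rope gives `c = κ u`, the loop gives `c₂ κ = c₁ κ v`, so the value below
    -- is `c₂ c = c₁ κ v u = (c₁ c) u⁻¹ v u`.
    rw [hkneg z h2 h3, h1, hmk, hcu, ← mul_assoc c₂, e3]
    group

end Noose

/-! ### Erasing the nooses from the local system -/

/-- Replacement of a local system on closed sets that meet at most in the point `p`: near the points
of these sets the sections are the multiples of given functions. -/
def LocalSystem.modify {X G ι : Type*} [TopologicalSpace X] [T1Space X] [Group G] [Finite ι]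
    (L : LocalSystem X G) (K : ι → Set X) (p : X) (k : ι → X → G) (hK : ∀ i, IsClosed (K i))
    (hdisj : ∀ i j, i ≠ j → K i ∩ K j ⊆ {p})
    (hk : ∀ i, ∀ z ∈ K i, z ≠ p → ∀ᶠ y in 𝓝 z, y ∉ K i → L.Sec (k i) y) : LocalSystem X G where
  -- On `K i` the sections of `L` are forgotten, so that crossings inside become harmless; `hk`
  -- makes the two alternatives fit together at the boundary.
  Sec f z := z ≠ p ∧ (((∀ i, z ∉ K i) ∧ L.Sec f z) ∨
    ∃ i, z ∈ K i ∧ ∃ c, ∀ᶠ y in 𝓝 z, f y = c * k i y)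
  congr := by
    rintro f f' z h ⟨hz, ⟨hzK, hf⟩ | ⟨i, hi, c, hc⟩⟩
    · exact ⟨hz, Or.inl ⟨hzK, L.congr h hf⟩⟩
    · exact ⟨hz, Or.inr ⟨i, hi, c, hc.congr (h.mono fun y hy => by rw [hy])⟩⟩
  smul := by
    rintro f z g ⟨hz, ⟨hzK, hf⟩ | ⟨i, hi, c, hc⟩⟩
    · exact ⟨hz, Or.inl ⟨hzK, L.smul g hf⟩⟩
    · exact ⟨hz, Or.inr ⟨i, hi, g * c, hc.mono fun y hy => by simp only [hy, mul_assoc]⟩⟩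
  unique := by
    rintro f f' z ⟨hz, ⟨hzK, hf⟩ | ⟨i, hi, c, hc⟩⟩ ⟨-, ⟨hzK', hf'⟩ | ⟨j, hj, c', hc'⟩⟩
    · exact L.unique hf hf'
    · exact absurd hj (hzK j)
    · exact absurd hi (hzK' i)
    · obtain rfl : i = j := by
        by_contra hne
        exact hz (hdisj i j hne ⟨hi, hj⟩)
      refine ⟨c' * c⁻¹, ?_⟩
      filter_upwards [hc, hc'] with y h1 h2
      rw [h1, h2]; group
  eventually := by
    rintro f z ⟨hz, ⟨hzK, hf⟩ | ⟨i, hi, c, hc⟩⟩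
    · filter_upwards [isOpen_ne.mem_nhds hz, L.eventually hf,
        eventually_all.2 fun i => (hK i).isOpen_compl.mem_nhds (hzK i)] with y h1 h2 h3
      exact ⟨h1, Or.inl ⟨h3, h2⟩⟩
    · have hother : ∀ᶠ y in 𝓝 z, ∀ j, j ≠ i → y ∉ K j := by
        refine eventually_all.2 fun j => ?_
        by_cases hj : j = i
        · simp [hj]
        · filter_upwards [(hK j).isOpen_compl.mem_nhds fun hzj => hz (hdisj j i hj ⟨hzj, hi⟩)]
            with y hy _
          exact hy
      filter_upwards [isOpen_ne.mem_nhds hz, hk i z hi hz, hother, hc.eventually_nhds]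
        with y h1 h2 h3 h4
      refine ⟨h1, ?_⟩
      by_cases hy : y ∈ K i
      · exact Or.inr ⟨i, hy, c, h4⟩
      · refine Or.inl ⟨fun j => ?_, ?_⟩
        · by_cases hj : j = i
          · rwa [hj]
          · exact h3 j hj
        · refine L.congr ?_ (L.smul c (h2 hy))
          filter_upwards [h4] with x hx
          exact hx.symm

/-! ### Small circles around the root of a noose -/

namespace Noose

variable (N : Noose)

theorem hasDerivAt_ropePath {x : ℝ} (hx : x ∈ Icc (1 : ℝ) 2) :
    HasDerivAt N.ropePath (fderiv ℝ N.toFun x 1) x := by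
  have h1 := ((N.contDiffAt (ofReal_mem_nooseModel hx)).differentiableAt (by simp)).hasFDerivAt
  have h2 : HasDerivAt (fun x : ℝ => (x : ℂ)) 1 x := Complex.ofRealCLM.hasDerivAt
  exact h1.comp_hasDerivAt x h2

theorem fderiv_one_ne_zero {z : ℂ} (hz : z ∈ nooseModel) : fderiv ℝ N.toFun z 1 ≠ 0 := by
  intro h0
  have := cross_map (fderiv ℝ N.toFun z) 1 Complex.I
  rw [h0] at this
  simp only [cross, Complex.zero_re, Complex.zero_im, Complex.one_re, Complex.one_im,
    Complex.I_re, Complex.I_im] at this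
  linarith [N.orientation z hz]

/-- The expression is the inner product of the velocity with the vector from the root, which is `(x
- 2)` times a slope tending to the velocity at the root. -/
theorem eventually_rope_inner_neg : ∀ᶠ x : ℝ in 𝓝[<] (2 : ℝ),
    (fderiv ℝ N.toFun x 1 * (starRingEnd ℂ) (N.ropePath x - N.root)).re < 0 := by
  have h2 : (2 : ℝ) ∈ Icc (1 : ℝ) 2 := ⟨one_le_two, le_rfl⟩
  have hmem := ofReal_mem_nooseModel h2
  have hslope := hasDerivAt_iff_tendsto_slope.1 (N.hasDerivAt_ropePath h2)
  have hfd : ContinuousAt (fun x : ℝ => fderiv ℝ N.toFun x 1) 2 := by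
    have h3 : ContinuousAt (fderiv ℝ N.toFun) ((2 : ℝ) : ℂ) :=
      ((N.contDiffAt hmem).fderiv_right (m := 0) (by simp)).continuousAt
    exact ContinuousAt.clm_apply (ContinuousAt.comp (f := fun x : ℝ => (x : ℂ)) h3
      Complex.continuous_ofReal.continuousAt) continuousAt_const
  have hlim := ((hfd.tendsto.mono_left (nhdsWithin_le_nhds (s := {2}ᶜ))).mul
    ((Complex.continuous_conj.tendsto _).comp hslope))
  have hpos : 0 < (fderiv ℝ N.toFun (2 : ℝ) 1 *
      (starRingEnd ℂ) (fderiv ℝ N.toFun (2 : ℝ) 1)).re := by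
    rw [Complex.mul_conj, Complex.ofReal_re]
    exact Complex.normSq_pos.2 (N.fderiv_one_ne_zero hmem)
  have hev := ((Complex.continuous_re.tendsto _).comp hlim).eventually (lt_mem_nhds hpos)
  filter_upwards [nhdsLT_le_nhdsNE 2 hev, self_mem_nhdsWithin] with x h3 h4
  have h5 : x - 2 < 0 := sub_neg.2 h4
  have h6 : N.ropePath x - N.root = (x - 2 : ℝ) * slope N.ropePath 2 x := by
    rw [slope_def_module, ← N.ropePath_two, Complex.real_smul, ← mul_assoc, ← Complex.ofReal_mul,
      mul_inv_cancel₀ h5.ne, Complex.ofReal_one, one_mul]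
  rw [h6, map_mul, Complex.conj_ofReal, mul_left_comm, Complex.re_ofReal_mul]
  exact mul_neg_of_neg_of_pos h5 h3

/-- Every small circle around the root meets the noose at most once, in a point of the rope, which
approaches the root from there. -/
theorem eventually_circle : ∀ᶠ r in 𝓝[>] (0 : ℝ),
    (∀ z ∈ N.image, ∀ z' ∈ N.image, ‖z - N.root‖ = r → ‖z' - N.root‖ = r → z = z') ∧
    ∀ x ∈ Icc (1 : ℝ) 2, ‖N.ropePath x - N.root‖ = r → x ∈ Ioo (1 : ℝ) 2 ∧
      (∀ x' ∈ Icc x 2, ‖N.ropePath x' - N.root‖ ≤ r) ∧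
      (fderiv ℝ N.toFun x 1 * (starRingEnd ℂ) (N.ropePath x - N.root)).re < 0 := by
  obtain ⟨x₀, hx₀, hneg⟩ : ∃ x₀ ∈ Ioo (1 : ℝ) 2, ∀ x ∈ Ioo x₀ 2,
      (fderiv ℝ N.toFun x 1 * (starRingEnd ℂ) (N.ropePath x - N.root)).re < 0 := by
    obtain ⟨l, hl, hsub⟩ := mem_nhdsLT_iff_exists_Ioo_subset.1 N.eventually_rope_inner_neg
    have hl2 : l < 2 := hl
    have hm1 := le_max_left l 1
    have hm2 := le_max_right l 1
    have hm3 : max l 1 < 2 := max_lt hl2 one_lt_two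
    exact ⟨(max l 1 + 2) / 2, ⟨by linarith, by linarith⟩,
      fun x hx => hsub ⟨by linarith [hx.1], hx.2⟩⟩
  -- Half the derivative of the squared distance is this inner product, so the distance to the root
  -- strictly decreases on `[x₀, 2]`.
  have hder : ∀ x ∈ Icc (1 : ℝ) 2, HasDerivAt (fun x => Complex.normSq (N.ropePath x - N.root))
      (2 * (fderiv ℝ N.toFun x 1 * (starRingEnd ℂ) (N.ropePath x - N.root)).re) x := by
    intro x hx
    have h1 := (N.hasDerivAt_ropePath hx).sub_const N.root
    have h2 : HasDerivAt (fun x => (N.ropePath x - N.root).re) _ x :=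
      Complex.reCLM.hasFDerivAt.comp_hasDerivAt x h1
    have h3 : HasDerivAt (fun x => (N.ropePath x - N.root).im) _ x :=
      Complex.imCLM.hasFDerivAt.comp_hasDerivAt x h1
    refine ((h2.mul h2).add (h3.mul h3)).congr_deriv ?_
    simp only [Complex.reCLM_apply, Complex.imCLM_apply, Complex.mul_re, Complex.conj_re,
      Complex.conj_im]
    ring
  have hanti : StrictAntiOn (fun x => Complex.normSq (N.ropePath x - N.root)) (Icc x₀ 2) := by
    refine strictAntiOn_of_deriv_neg (convex_Icc _ _) (fun x hx => ?_) fun x hx => ?_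
    · exact (hder x ⟨hx₀.1.le.trans hx.1, hx.2⟩).continuousAt.continuousWithinAt
    · rw [interior_Icc] at hx
      rw [(hder x ⟨(hx₀.1.trans hx.1).le, hx.2.le⟩).deriv]
      linarith [hneg x hx]
  have hanti' : ∀ x ∈ Icc x₀ 2, ∀ x' ∈ Icc x₀ 2,
      ‖N.ropePath x - N.root‖ = ‖N.ropePath x' - N.root‖ → x = x' := fun x hx x' hx' h =>
    hanti.injOn hx hx' (by simp only [Complex.normSq_eq_norm_sq, h])
  -- The rest of the noose is compact and, by injectivity, misses the root; small circles do not
  -- reach it.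
  have hT : IsCompact (N.toFun '' (nooseModel ∩ {z | z.re ≤ x₀})) :=
    (isCompact_nooseModel.inter_right
      (isClosed_le Complex.continuous_re continuous_const)).image_of_continuousOn
      (N.continuousOn.mono inter_subset_left)
  have hroot : N.root ∈ (N.toFun '' (nooseModel ∩ {z | z.re ≤ x₀}))ᶜ := by
    rintro ⟨z, ⟨hz, hzre⟩, hzr⟩
    have h2 : (2 : ℂ) ∈ nooseModel := by
      exact_mod_cast ofReal_mem_nooseModel (x := 2) ⟨one_le_two, le_rfl⟩
    have := N.injOn hz h2 hzr
    rw [this] at hzre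
    have : (2 : ℝ) ≤ x₀ := by simpa using hzre
    linarith [hx₀.2]
  obtain ⟨ε, hε, hball⟩ := Metric.isOpen_iff.1 hT.isClosed.isOpen_compl _ hroot
  have hclose : ∀ z ∈ nooseModel, ‖N.toFun z - N.root‖ < ε → ∃ x ∈ Ioc x₀ 2, (x : ℂ) = z := by
    intro z hz hzε
    have hre : x₀ < z.re := by
      by_contra hcon
      exact hball (mem_ball_iff_norm.2 hzε) ⟨z, ⟨hz, not_lt.1 hcon⟩, rfl⟩
    rcases hz with hz | ⟨x, hx, rfl⟩
    · have := (Complex.re_le_norm z).trans (mem_closedBall_zero_iff.1 hz)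
      linarith [hx₀.1]
    · exact ⟨x, ⟨hre, hx.2⟩, rfl⟩
  filter_upwards [Ioo_mem_nhdsGT hε] with r hr
  refine ⟨?_, ?_⟩
  · rintro _ ⟨z, hz, rfl⟩ _ ⟨z', hz', rfl⟩ h1 h2
    obtain ⟨x, hx, rfl⟩ := hclose z hz (h1 ▸ hr.2)
    obtain ⟨x', hx', rfl⟩ := hclose z' hz' (h2 ▸ hr.2)
    rw [hanti' x ⟨hx.1.le, hx.2⟩ x' ⟨hx'.1.le, hx'.2⟩ (h1.trans h2.symm)]
  · intro x hx hxr
    obtain ⟨x', hx', hxx'⟩ := hclose x (ofReal_mem_nooseModel hx) (by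
      rw [show N.toFun x = N.ropePath x from rfl, hxr]; exact hr.2)
    obtain rfl : x' = x := by exact_mod_cast hxx'
    have hx2 : x' ≠ 2 := by
      rintro rfl
      rw [ropePath_two, sub_self, norm_zero] at hxr
      exact hr.1.ne hxr
    have hlt : x' < 2 := lt_of_le_of_ne hx'.2 hx2
    refine ⟨⟨hx₀.1.trans hx'.1, hlt⟩, fun y hy => ?_, hneg x' ⟨hx'.1, hlt⟩⟩
    have := hanti.antitoneOn ⟨hx'.1.le, hx'.2⟩ ⟨hx'.1.le.trans hy.1, hy.2⟩ hy.1
    simp only [Complex.normSq_eq_norm_sq, hxr] at this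
    exact le_of_sq_le_sq this hr.1.le

variable {N} {S : Type*} {D : ColoredDiagram S}

/-- There is a function that is a section off the noose, near the noose, and that jumps by the word of
the noose when the rope is passed counterclockwise along a small circle around the root. -/
theorem IsFor.exists_cut (h : N.IsFor D) {u v : SignedWord S}
    (hu : D.IsIntersectionWord N.ropePath 1 2 u) (hv : D.IsIntersectionWord N.loopPath 0 1 v) :
    ∃ k : ℂ → FreeGroup S,
      (∀ z ∈ N.image, z ≠ N.root → ∀ᶠ y in 𝓝 z, y ∉ N.image → D.localSystem.Sec k y) ∧
      ∀ᶠ r : ℝ in 𝓝[>] 0, ∀ θ : ℝ, N.root + r * Complex.exp (θ * Complex.I) ∈ N.rope →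
        JumpsAt (fun t : ℝ => k (N.root + r * Complex.exp (t * Complex.I))) θ
          (FreeGroup.mk (conjWord v u)) := by
  obtain ⟨k, hk, hjump⟩ := h.exists_model_cut hu hv
  -- The noose map stays injective on a neighbourhood of the compact model, so the model function
  -- can be transported to the plane.
  obtain ⟨V, hV, hXV, hinj⟩ := N.injOn.exists_isOpen_superset isCompact_nooseModel
    (fun z hz => N.continuousAt hz) fun z hz => by
      obtain ⟨e, he, hze, -⟩ := N.exists_chart hz
      exact ⟨e.source, e.open_source.mem_nhds hze, he ▸ e.injOn⟩
  set k' : ℂ → FreeGroup S := fun y => k (Function.invFunOn N.toFun V y) with hk'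
  have hk'V : ∀ z ∈ V, k' (N.toFun z) = k z := fun z hz => by
    simp only [hk', hinj.leftInvOn_invFunOn hz]
  refine ⟨k', ?_, ?_⟩
  · rintro _ ⟨x, hx, rfl⟩ hne
    obtain ⟨e, he, hxe, -⟩ := N.exists_chart hx
    have hx2 : x ≠ 2 := by rintro rfl; exact hne rfl
    rw [← he, ← e.map_nhds_eq hxe, eventually_map, he]
    filter_upwards [hk x hx hx2, hV.mem_nhds (hXV hx), e.open_source.mem_nhds hxe] with z h1 h2 h3 h4
    obtain ⟨-, f, hf, hkf⟩ := h1 fun hz => h4 ⟨z, hz, rfl⟩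
    refine LocalSystem.congr _ ?_ hf
    rw [EventuallyEq, ← he, ← e.map_nhds_eq h3, eventually_map, he]
    filter_upwards [hkf, hV.mem_nhds h2] with y h5 h6
    rw [hk'V y h6, h5, Function.comp_apply]
  -- Within distance `ε` of the root there is no diagram, so the rope meets no component between the
  -- circle and the root, as `hjump` demands.
  · obtain ⟨ε, hε, hball⟩ := Metric.isOpen_iff.1 D.isCompact_support.isClosed.isOpen_compl _
      h.root_notMem
    filter_upwards [N.eventually_circle, Ioo_mem_nhdsGT hε] with r hcirc hr θ hθ
    obtain ⟨_, ⟨x, hx, rfl⟩, hxθ⟩ := hθ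
    have hxθ' : N.ropePath x = N.root + r * Complex.exp (θ * Complex.I) := hxθ
    have hnorm : ‖N.ropePath x - N.root‖ = r := by
      rw [hxθ', add_sub_cancel_left, norm_mul, Complex.norm_exp_ofReal_mul_I, mul_one,
        Complex.norm_real, Real.norm_eq_abs, abs_of_pos hr.1]
    obtain ⟨hxI, hxr, hneg⟩ := hcirc.2 x hx hnorm
    obtain ⟨c, hc⟩ := hjump x hxI fun x' hx' =>
      hball (mem_ball_iff_norm.2 ((hxr x' hx').trans_lt hr.2))
    have hxX := ofReal_mem_nooseModel hx
    obtain ⟨e, he, hxe, f', hf', hf'inv⟩ := N.exists_chart hxX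
    set β : ℝ → ℂ := fun t => N.root + r * Complex.exp (t * Complex.I) with hβ
    have hβθ : β θ = N.toFun x := hxθ.symm
    have hβder : HasDerivAt β (Complex.I * (N.ropePath x - N.root)) θ := by
      have h1 : HasDerivAt (fun t : ℝ => (t : ℂ) * Complex.I) (1 * Complex.I) θ :=
        (Complex.ofRealCLM.hasDerivAt (x := θ)).mul_const Complex.I
      have h2 := (h1.cexp.const_mul (r : ℂ)).const_add N.root
      refine h2.congr_deriv ?_
      rw [hxθ']; ring
    rw [← hβθ] at hf'
    have hy := Complex.imCLM.hasFDerivAt.comp_hasDerivAt θ (hf'.comp_hasDerivAt θ hβder)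
    have hsymm : e.symm (β θ) = x := by rw [hβθ, ← he, e.left_inv hxe]
    have htgt : β θ ∈ e.target := by rw [hβθ, ← he]; exact e.map_source hxe
    -- The circle has tangent `I * (p - root)` at a point `p`, whose `cross` with the rope velocity
    -- is the negative inner product. As the noose map preserves orientation, the circle passes in
    -- the model from above the rope to below.
    have hpos : 0 < -(f' (Complex.I * (N.ropePath x - N.root))).im := by
      have h1 := cross_map (fderiv ℝ N.toFun x) 1 (f' (Complex.I * (N.ropePath x - N.root)))
      rw [hf'inv] at h1
      have h2 : cross 1 (f' (Complex.I * (N.ropePath x - N.root))) =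
          (f' (Complex.I * (N.ropePath x - N.root))).im := by simp [cross]
      have h3 : cross (fderiv ℝ N.toFun x 1) (Complex.I * (N.ropePath x - N.root)) =
          (fderiv ℝ N.toFun x 1 * (starRingEnd ℂ) (N.ropePath x - N.root)).re := by
        simp only [cross, Complex.mul_re, Complex.mul_im, Complex.I_re, Complex.I_im,
          Complex.conj_re, Complex.conj_im]
        ring
      rw [h2, h3] at h1
      rw [h1] at hneg
      have h4 := N.orientation x hxX
      by_contra hcon
      have := mul_nonneg h4.le (show 0 ≤ (f' (Complex.I * (N.ropePath x - N.root))).im by linarith)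
      linarith
    obtain ⟨hl, hr'⟩ := ColoredDiagram.eventually_sign_of_hasDerivAt hy.neg
      (by simp [hsymm]) hpos
    have hcontβ : Tendsto (fun t => e.symm (β t)) (𝓝 θ) (𝓝 (x : ℂ)) := by
      rw [← hsymm]
      exact (e.continuousAt_symm htgt).comp hβder.continuousAt
    have hev : ∀ᶠ t in 𝓝 θ, (0 < (e.symm (β t)).im → k' (β t) = c) ∧
        ((e.symm (β t)).im < 0 → k' (β t) = c * FreeGroup.mk (conjWord v u)) := by
      filter_upwards [hcontβ.eventually hc, hcontβ.eventually (hV.mem_nhds (hXV hxX)),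
        hβder.continuousAt.eventually (e.open_target.mem_nhds htgt)] with t h1 h2 h3
      have h4 : N.toFun (e.symm (β t)) = β t := by rw [← he, e.right_inv h3]
      have h5 := hk'V _ h2
      rw [h4] at h5
      rwa [h5]
    refine ⟨c, ?_, ?_⟩
    · filter_upwards [hl, nhdsWithin_le_nhds hev] with t h1 h2
      exact h2.1 (by simpa using h1)
    · filter_upwards [hr', nhdsWithin_le_nhds hev] with t h1 h2
      exact h2.2 (by simpa using h1)

end Noose

/-! ### The product of the words of a noose system -/

theorem mk_flatten {S : Type*} (l : List (SignedWord S)) :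
    FreeGroup.mk l.flatten = (l.map FreeGroup.mk).prod := by
  induction l with
  | nil => rfl
  | cons w l ih => rw [List.flatten_cons, ← FreeGroup.mul_mk, ih, List.map_cons, List.prod_cons]

/-- The angle `t` is the midpoint of the gap between `θ (Fin.last m) - a` and `θ 0`. -/
theorem exists_lt_forall_lt_add {m : ℕ} {θ : Fin m → ℝ} (hθ : StrictMono θ) {a : ℝ}
    (h : ∀ i j, θ j < θ i + a) : ∃ t, ∀ i, t < θ i ∧ θ i < t + a := by
  cases m with
  | zero => exact ⟨0, fun i => i.elim0⟩
  | succ m =>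
    refine ⟨(θ 0 + (θ (Fin.last m) - a)) / 2, fun i => ?_⟩
    have h1 := h 0 (Fin.last m)
    have h2 := hθ.monotone (Fin.zero_le i)
    have h3 := hθ.monotone (Fin.le_last i)
    constructor <;> linarith

theorem exp_log_add_mul_I {r : ℝ} (hr : 0 < r) (t : ℝ) :
    Complex.exp (Real.log r + t * Complex.I) = r * Complex.exp (t * Complex.I) := by
  rw [Complex.exp_add, ← Complex.ofReal_exp, Real.exp_log hr]

theorem eq_of_exp_mul_I_eq {s t a : ℝ} (hs : s ∈ Icc a (a + 2 * Real.pi))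
    (ht : t ∈ Ioo a (a + 2 * Real.pi))
    (h : Complex.exp (s * Complex.I) = Complex.exp (t * Complex.I)) : s = t := by
  obtain ⟨n, hn⟩ := Complex.exp_eq_exp_iff_exists_int.1 h
  have h1 : s = t + n * (2 * Real.pi) := by
    have := congrArg Complex.im hn
    simpa using this
  have hpi := Real.pi_pos
  have h2 : (n : ℝ) < 1 := by
    by_contra! hcon
    nlinarith [hs.2, ht.1]
  have h3 : (-1 : ℝ) < n := by
    by_contra! hcon
    nlinarith [hs.1, ht.2]
  have h4 : n = 0 := by
    have h5 : n < 1 := by exact_mod_cast h2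
    have h6 : -1 < n := by exact_mod_cast h3
    omega
  rw [h1, h4]; simp

namespace NooseSystem

variable {S : Type*} {D : ColoredDiagram S} {m : ℕ} {N : NooseSystem m}

theorem IsFor.prod_words (hN : N.IsFor D) {u v : Fin m → SignedWord S}
    (hu : ∀ i, D.IsIntersectionWord (N.noose i).ropePath 1 2 (u i))
    (hv : ∀ i, D.IsIntersectionWord (N.noose i).loopPath 0 1 (v i)) :
    (List.ofFn fun i => FreeGroup.mk (conjWord (v i) (u i))).prod = 1 := by
  choose k hk hjump using fun i => (hN.noose_isFor i).exists_cut (hu i) (hv i)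
  have hcirc := fun i => (N.noose i).eventually_circle
  simp only [N.root_eq] at hk hjump hcirc
  set L := D.localSystem.modify (fun i => (N.noose i).image) N.base k
    (fun i => (N.noose i).isCompact_image.isClosed) (fun i j hij => (N.disjoint i j hij).subset) hk
  set E := L.comap fun ζ => N.base + Complex.exp ζ
  have hcont : Continuous fun ζ : ℂ => N.base + Complex.exp ζ := by fun_prop
  -- Off the nooses there are no crossings, so a section of the diagram exists; on a noose its cut
  -- function is one.
  have hex : ∀ ζ, ∃ f, E.Sec f ζ := by
    intro ζ
    have hne : N.base + Complex.exp ζ ≠ N.base := by simp [Complex.exp_ne_zero]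
    have : ∃ f, L.Sec f (N.base + Complex.exp ζ) := by
      by_cases hK : ∃ i, N.base + Complex.exp ζ ∈ (N.noose i).image
      · obtain ⟨i, hi⟩ := hK
        exact ⟨k i, hne, Or.inr ⟨i, hi, 1, by simp⟩⟩
      · push Not at hK
        obtain ⟨f, hf⟩ := ColoredDiagram.exists_isSectionAt (D := D) (z := N.base + Complex.exp ζ)
          fun hcr => by
            obtain ⟨i, hi⟩ := mem_iUnion.1 (hN.crossings_subset hcr)
            exact hK i (image_mono subset_union_left hi)
        exact ⟨f, hne, Or.inl ⟨hK, hf⟩⟩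
    obtain ⟨f, hf⟩ := this
    exact ⟨_, Eventually.of_forall fun y => hcont.continuousAt, f, hf, EventuallyEq.rfl⟩
  -- Without nooses nothing keeps `N.base` off the diagram, but then the product is empty.
  rcases isEmpty_or_nonempty (Fin m) with hm | ⟨⟨i₀⟩⟩
  · obtain rfl : m = 0 := by
      by_contra h0
      exact hm.false ⟨0, Nat.pos_of_ne_zero h0⟩
    simp
  have hb : N.base ∉ D.support := N.root_eq i₀ ▸ (hN.noose_isFor i₀).root_notMem
  obtain ⟨ε, hε, hball⟩ := Metric.isOpen_iff.1 D.isCompact_support.isClosed.isOpen_compl _ hb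
  obtain ⟨r, ⟨θ, hθmono, hθ2, hθrope⟩, hcirc, hjump, hr0, hrε⟩ :=
    (N.counterclockwise.and ((eventually_all.2 hcirc).and ((eventually_all.2 hjump).and
      (show ∀ᶠ r in 𝓝[>] (0 : ℝ), r ∈ Ioo 0 ε from Ioo_mem_nhdsGT hε)))).exists
  obtain ⟨a, ha⟩ := exists_lt_forall_lt_add hθmono hθ2
  obtain ⟨R, hrR, hR⟩ := ((isCompact_iUnion fun i => (N.noose i).isCompact_image).union
    D.isCompact_support).isBounded.subset_ball_lt r N.base
  have hR0 : 0 < R := hr0.trans hrR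
  have hpi := Real.pi_pos
  have hlog : Real.log r ≤ Real.log R := Real.log_le_log hr0 hrR.le
  obtain ⟨h, hh⟩ := E.exists_section_rectangle hlog (show a ≤ a + 2 * Real.pi by linarith)
    fun z _ => hex z
  -- the section along circles around the base point
  have hcircle : ∀ ρ, 0 < ρ → Real.log ρ ∈ Icc (Real.log r) (Real.log R) →
      ∀ t ∈ Icc a (a + 2 * Real.pi), ∃ f, L.Sec f (N.base + ρ * Complex.exp (t * Complex.I)) ∧
        ∀ᶠ s : ℝ in 𝓝 t, h (Real.log ρ + s * Complex.I) =
          f (N.base + ρ * Complex.exp (s * Complex.I)) := by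
    intro ρ hρ0 hρ t ht
    obtain ⟨-, f, hf, hhf⟩ := hh (Real.log ρ + t * Complex.I) ⟨by simpa using hρ, by simpa using ht⟩
    refine ⟨f, by simpa only [exp_log_add_mul_I hρ0] using hf, ?_⟩
    have : Continuous fun s : ℝ => (Real.log ρ + s * Complex.I : ℂ) := by fun_prop
    filter_upwards [this.continuousAt.eventually hhf] with s hs
    rw [hs, Function.comp_apply, exp_log_add_mul_I hρ0]
  have hnorm : ∀ ρ : ℝ, 0 < ρ → ∀ t : ℝ,
      ‖N.base + ρ * Complex.exp (t * Complex.I) - N.base‖ = ρ := by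
    intro ρ hρ0 t
    rw [add_sub_cancel_left, norm_mul, Complex.norm_exp_ofReal_mul_I, mul_one,
      Complex.norm_real, Real.norm_eq_abs, abs_of_pos hρ0]
  have hconst : ∀ ρ, 0 < ρ → Real.log ρ ∈ Icc (Real.log r) (Real.log R) →
      ∀ t ∈ Icc a (a + 2 * Real.pi),
      N.base + ρ * Complex.exp (t * Complex.I) ∉ D.support →
      (∀ i, N.base + ρ * Complex.exp (t * Complex.I) ∉ (N.noose i).image) →
      ∃ c, ∀ᶠ s : ℝ in 𝓝 t, h (Real.log ρ + s * Complex.I) = c := by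
    intro ρ hρ0 hρ t ht hD hK
    obtain ⟨f, ⟨-, ⟨-, hf⟩ | ⟨i, hi, -⟩⟩, hhf⟩ := hcircle ρ hρ0 hρ t ht
    · obtain ⟨c, hc⟩ := ColoredDiagram.IsSectionAt.exists_eventually_eq hf hD
      refine ⟨c, ?_⟩
      have hcont' : Continuous fun s : ℝ => N.base + ρ * Complex.exp (s * Complex.I) := by fun_prop
      filter_upwards [hhf, hcont'.continuousAt.eventually hc] with s h1 h2
      rw [h1, h2]
    · exact absurd hi (hK i)
  -- the monodromy of the section
  obtain ⟨c, hc⟩ := E.unique_of_isPreconnected (s := Icc (Real.log r) (Real.log R) ×ℂ {a})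
    (f := h) (f' := fun ζ => h (ζ + 2 * Real.pi * Complex.I))
    (LocalSystem.isPreconnected_reProdIm (convex_Icc _ _) (convex_singleton _))
    (fun z hz => hh z ⟨hz.1, by rw [mem_preimage, hz.2]; constructor <;> linarith⟩)
    (fun z hz => by
      obtain ⟨-, f, hf, hhf⟩ := hh (z + 2 * Real.pi * Complex.I) ⟨by simpa using hz.1, by
        have h1 : z.im = a := hz.2
        have h2 : (z + 2 * Real.pi * Complex.I).im = a + 2 * Real.pi := by simp [h1]
        rw [mem_preimage, h2]
        constructor <;> linarith⟩
      have hper : ∀ y, Complex.exp (y + 2 * Real.pi * Complex.I) = Complex.exp y :=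
        Complex.exp_periodic
      simp only [hper] at hf
      refine ⟨Eventually.of_forall fun y => hcont.continuousAt, f, hf, ?_⟩
      filter_upwards [(continuous_add_const (2 * Real.pi * Complex.I)).continuousAt.eventually hhf]
        with y hy
      rw [hy, Function.comp_apply, Function.comp_apply, hper])
  have hmono : ∀ ρ, 0 < ρ → Real.log ρ ∈ Icc (Real.log r) (Real.log R) →
      h (Real.log ρ + (a + 2 * Real.pi : ℝ) * Complex.I) =
        c * h (Real.log ρ + a * Complex.I) := by
    intro ρ hρ0 hρ
    have := (hc (Real.log ρ + a * Complex.I) ⟨by simpa using hρ, by simp⟩).self_of_nhds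
    rw [← this]
    congr 1
    push_cast; ring
  have hc1 : c = 1 := by
    have h1 := hmono R hR0 ⟨hlog, le_rfl⟩
    have h2 : h (Real.log R + (a + 2 * Real.pi : ℝ) * Complex.I) =
        h (Real.log R + a * Complex.I) := by
      refine eq_of_locally_constant (H := fun t : ℝ => h (Real.log R + t * Complex.I))
        (by linarith) fun t ht => hconst R hR0 ⟨hlog, le_rfl⟩ t ht ?_ ?_
      · intro hD
        exact (mem_ball_iff_norm.1 (hR (Or.inr hD))).ne (hnorm R hR0 t)
      · intro i hi
        exact (mem_ball_iff_norm.1 (hR (Or.inl (mem_iUnion.2 ⟨i, hi⟩)))).ne (hnorm R hR0 t)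
    rw [h2] at h1
    exact (mul_eq_right.1 h1.symm)
  have hrope : ∀ i, (N.noose i).rope ⊆ (N.noose i).image := fun i => image_mono subset_union_right
  -- On the small circle the only jumps are at the angles `θ i`, in this order.
  have hprod := eq_mul_prod_of_jumps (H := fun t : ℝ => h (Real.log r + t * Complex.I))
    (ts := List.ofFn θ) (gs := List.ofFn fun i => FreeGroup.mk (conjWord (v i) (u i)))
    (a := a) (b := a + 2 * Real.pi) (by
      rw [List.ofFn_eq_map, List.ofFn_eq_map, List.forall₂_map_left_iff, List.forall₂_map_right_iff,
        List.forall₂_same]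
      intro i _
      obtain ⟨f, ⟨hne, hf⟩, hhf⟩ := hcircle r hr0 ⟨le_rfl, hlog⟩ (θ i) ⟨(ha i).1.le, (ha i).2.le⟩
      rcases hf with ⟨hK, -⟩ | ⟨j, hj, c', hc'⟩
      · exact absurd (hrope i (hθrope i)) (hK i)
      · obtain rfl : i = j := by
          by_contra hij
          exact hne ((N.disjoint i j hij).subset ⟨hrope i (hθrope i), hj⟩)
        refine (hjump i (θ i) (hθrope i)).congr_mul c' ?_
        have hcont' : Continuous fun s : ℝ => N.base + r * Complex.exp (s * Complex.I) := by
          fun_prop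
        filter_upwards [nhdsWithin_le_nhds hhf,
          nhdsWithin_le_nhds (hcont'.continuousAt.eventually hc')] with s h1 h2
        rw [h1, h2])
    (by linarith) (List.pairwise_ofFn.2 fun i j hij => hθmono hij)
    (fun t ht => by
      obtain ⟨i, rfl⟩ := (List.mem_ofFn' _ _).1 ht
      exact ha i)
    (fun t ht htn => by
      refine hconst r hr0 ⟨le_rfl, hlog⟩ t ht (hball (mem_ball_iff_norm.2 ?_)) fun i hi => ?_
      · rw [hnorm r hr0]; exact hrε
      · have h1 := (hcirc i).1 _ hi _ (hrope i (hθrope i)) (hnorm r hr0 t) (hnorm r hr0 (θ i))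
        have h2 : Complex.exp (t * Complex.I) = Complex.exp (θ i * Complex.I) :=
          mul_left_cancel₀ (Complex.ofReal_ne_zero.2 hr0.ne') (add_left_cancel h1)
        exact htn ((List.mem_ofFn' _ _).2 ⟨i, (eq_of_exp_mul_I_eq ht (ha i) h2).symm⟩))
  have h1 := hmono r hr0 ⟨le_rfl, hlog⟩
  rw [hc1, one_mul] at h1
  rw [h1] at hprod
  exact mul_eq_left.1 hprod.symm

end NooseSystem

-- Since `⁅g, h⁆ = g * h * g⁻¹ * h⁻¹`, the word `(a, b)` is the commutator of the inverses.
open scoped commutatorElement in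
theorem mk_conjWord_commWord_mem_commutator {S : Type*} (a b u : SignedWord S) :
    FreeGroup.mk (conjWord (commWord a b) u) ∈ commutator (FreeGroup S) := by
  have h : FreeGroup.mk (conjWord (commWord a b) u) =
      (FreeGroup.mk u)⁻¹ * ⁅(FreeGroup.mk a)⁻¹, (FreeGroup.mk b)⁻¹⁆ * ((FreeGroup.mk u)⁻¹)⁻¹ := by
    simp only [conjWord, commWord, ← FreeGroup.mul_mk, ← FreeGroup.inv_mk, commutatorElement_def,
      inv_inv]
  rw [h]
  exact (inferInstance : (commutator (FreeGroup S)).Normal).conj_mem _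
    (Subgroup.commutator_mem_commutator (Subgroup.mem_top _) (Subgroup.mem_top _)) _

end Doodle

/-- Every noose of the system has exactly one intersection word with `D`, and the identity
`w₁ ⋯ wₘ ≡ 1` formed by these words is an elementary commutator identity. -/
theorem theorem2p3 {S : Type*} (D : Doodle.ColoredDiagram S) {m : ℕ}
    (N : Doodle.NooseSystem m) (hN : N.IsFor D) (hproper : N.IsProper D) :
    (∀ i, ∃! w : Doodle.SignedWord S, (N.noose i).IsIntersectionWord D w) ∧
      ∀ w : Fin m → Doodle.SignedWord S,
        (∀ i, (N.noose i).IsIntersectionWord D (w i)) →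
          Doodle.IsElementaryCommutatorIdentity w := by
  choose u hu using fun i => (hN.noose_isFor i).exists_rope_word
  choose a b hv using fun i => (hproper i).exists_loop_word
  have hw := fun i => (hN.noose_isFor i).isIntersectionWord (hu i) (hv i)
  -- Uniqueness turns the computed word into the given one, letter by letter and not only in the
  -- free group.
  have huniq : ∀ i w, (N.noose i).IsIntersectionWord D w → w = _ := fun i w h =>
    h.eq (hN.noose_isFor i).path_notMem_crossings (hw i)
  refine ⟨fun i => ⟨_, hw i, huniq i⟩, fun w h => ?_⟩
  obtain rfl : w = _ := funext fun i => huniq i (w i) (h i)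
  refine ⟨⟨fun i => Doodle.mk_conjWord_commWord_mem_commutator _ _ _, ?_⟩, a, b, u, fun i => rfl⟩
  rw [Doodle.mk_flatten, List.map_ofFn]
  exact hN.prod_words hu hv
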